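/- A binary matrix is a matrix with all entries in $\{-1,1\}$; the discrepancy $\operatorname{disc}(M)$ of a matrix $M$ is the sum of all its entries. A square in $M=(a_{i,j})$ is a $2\times 2$ submatrix of the form $\begin{pmatrix} a_{i,j} & a_{i,j+s}\\ a_{i+s,j} & a_{i+s,j+s}\end{pmatrix}$ with $s\ge 1$ an integer, and it is a zero-sum square if its four entries sum to $0$. An $n\times m$ binary matrix is $t$-split, where $t$ is an integer with $0\le t<n+m$, if for all $1\le i\le n$, $1\le j\le m$ one has $a_{i,j}=-1$ when $i+j\le t+1$ and $a_{i,j}=1$ otherwise. A matrix $M$ is split if $M$, its negative $-M$, its horizontal reflection or its vertical reflection is $t$-split for some $t$. **Corollary 1.4.** Let $n\ge 5$ and let $M$ be an $n\times n$ binary matrix with $|\operatorname{disc}(M)|\le n-1$. Then $M$ contains a zero-sum square. (No exception for split matrices is needed: for every $n$, each $n\times n$ split matrix $M$ with $|\operatorname{disc}(M)|\le n$ satisfies $|\operatorname{disc}(M)|=n$.) -/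

import Mathlib

/-- A binary matrix is a matrix all of whose entries are `1` or `-1`. -/
def IsBinary {n m : ℕ} (M : Matrix (Fin n) (Fin m) ℤ) : Prop :=
  ∀ i j, M i j = 1 ∨ M i j = -1

/-- The discrepancy of a matrix is the sum of all its entries. -/
def disc {n m : ℕ} (M : Matrix (Fin n) (Fin m) ℤ) : ℤ :=
  ∑ i, ∑ j, M i j

/-- The `2 × 2` submatrix of `M` on the rows `i, i + s` and the columns `j, j + s`
(rows and columns are numbered from `0`). -/
def squareAt {n m : ℕ} (M : Matrix (Fin n) (Fin m) ℤ) (i j s : ℕ)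
    (hi : i + s < n) (hj : j + s < m) : Matrix (Fin 2) (Fin 2) ℤ :=
  !![M ⟨i, by omega⟩ ⟨j, by omega⟩, M ⟨i, by omega⟩ ⟨j + s, hj⟩;
     M ⟨i + s, hi⟩ ⟨j, by omega⟩, M ⟨i + s, hi⟩ ⟨j + s, hj⟩]

/-- `M` contains a zero-sum square: a square with positive side `s` and discrepancy `0`. -/
def HasZeroSumSquare {n m : ℕ} (M : Matrix (Fin n) (Fin m) ℤ) : Prop :=
  ∃ (i j s : ℕ) (hi : i + s < n) (hj : j + s < m),
    0 < s ∧ disc (squareAt M i j s hi hj) = 0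

/-- `M` is `t`-split: `0 ≤ t < n + m`, the entry in row `i` and column `j` (numbered from `1`)
is `-1` if `i + j ≤ t + 1`, and all other entries are `1`. -/
def IsTSplit {n m : ℕ} (t : ℕ) (M : Matrix (Fin n) (Fin m) ℤ) : Prop :=
  t < n + m ∧
    ∀ (i : Fin n) (j : Fin m),
      M i j = if ((i : ℕ) + 1) + ((j : ℕ) + 1) ≤ t + 1 then -1 else 1

/-- `M` is split: `M`, its negative, or one of its two reflections (reversing the order of the
columns, or that of the rows) is `t`-split for some `t`. -/
def IsSplit {n m : ℕ} (M : Matrix (Fin n) (Fin m) ℤ) : Prop :=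
  ∃ t : ℕ, IsTSplit t M ∨ IsTSplit t (-M) ∨
    IsTSplit t (M.submatrix id Fin.rev) ∨ IsTSplit t (M.submatrix Fin.rev id)

/-! The first claim is strengthened to `SmallSumSplit`: a rectangle with sides at least `5` that
differ by at most `1`, without zero-sum squares and with sum smaller in absolute value than the
longer side, is split by an antidiagonal cut through its centre. Parity excludes such a cut in a
square (`not_anyMidSplit_square`), so small squares with no zero-sum square do not exist.

The strengthening is proved by induction that halves the size (`smallSumSplit_all`). In a rectangle
of sides about `2 * m`, consider the windows with sides `m` or `m + 1`. If each has a sum at least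
its longer side in absolute value, then adding or dropping a line cannot change the sign of a sum.
All windows then share a sign, and four of them tile the rectangle, whose sum is at least `4 * m` in
absolute value (`LargeWindows.four_mul_le`): too large. Otherwise some window has a small sum; by
induction it is split through its centre, so its sides are `m` and `m + 1`. Its cut propagates to a
split `d × d` corner of the rectangle (`splitAt_corner`). Unless the cut passes through the centre
of the rectangle, the entries forced to be `1` beyond this corner make the sum at least the longer
side (`corner_bound`, `MidSplit.extend`).

The smallest sizes rest on exhaustive searches over `5 × 5`, `5 × 6` and `6 × 6` matrices.

For the second claim, the discrepancy of a `t`-split matrix decreases with `t` and jumps from `n` at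
`t = n - 1` to `-n` at `t = n`. -/

/-! ### Exhaustive search over small matrices -/

/-- The sum `F 0 + ⋯ + F (n - 1)`, in a form suited to kernel evaluation. -/
def sumBelow (F : ℕ → ℕ) (n : ℕ) : ℕ := Nat.rec 0 (fun i ih => Nat.add (F i) ih) n

/-- Whether `F i` holds for all `i < n`. -/
def allBelow (F : ℕ → Bool) (n : ℕ) : Bool := Nat.rec true (fun i ih => and (F i) ih) n

/-- Whether `F i` holds for some `i < n`. -/
def anyBelow (F : ℕ → Bool) (n : ℕ) : Bool := Nat.rec false (fun i ih => or (F i) ih) n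

/-- The binary digit of `m` with weight `2 ^ i`. -/
def bitOf (m i : ℕ) : ℕ := Nat.mod (Nat.shiftRight m i) 2

/-- A matrix with `Q` columns is filled row by row; the entries so far are the binary digits of
`m`, the last one having weight `1`. The test says that the entry `v` may follow: it is not the
last corner of a zero-sum square of side at most `t`. -/
def cellFits (m Q v t : ℕ) : Bool :=
  -- Digit `t` of `m` is the entry `t + 1` cells back. The three digits read are thus the cells at
  -- distance `d + 1` to the left, above, and diagonally up left. Four signs cancel when exactly two
  -- of their digits are `1`.
  Nat.rec true (fun d ih =>
    cond (Nat.beq (Nat.add (Nat.add (bitOf m d) (bitOf m (Nat.sub (Nat.mul (Nat.succ d) Q) 1)))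
      (Nat.add v (bitOf m (Nat.add d (Nat.mul (Nat.succ d) Q))))) 2) false ih) t

/-- The smaller of the row and the column of cell number `k`. -/
def cellDepth (Q k : ℕ) : ℕ :=
  cond (Nat.ble (Nat.div k Q) (Nat.mod k Q)) (Nat.div k Q) (Nat.mod k Q)

/-- Whether all ways to add `n` entries to the `k` entries coded by `m`, of which `c` are ones,
without completing a zero-sum square lead to matrices with the property `R`, or with at least `h`
ones, or with at least `h` zeros. -/
def search (Q h : ℕ) (R : ℕ → Bool) (n : ℕ) : ℕ → ℕ → ℕ → Bool :=
  Nat.rec (fun _ _ m => R m) (fun _ ih k c m =>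
    cond (cond (cond (Nat.ble h (Nat.succ c)) false (cellFits m Q 1 (cellDepth Q k)))
        (ih (Nat.succ k) (Nat.succ c) (Nat.succ (Nat.mul 2 m))) true)
      (cond (cond (Nat.ble h (Nat.succ (Nat.sub k c))) false (cellFits m Q 0 (cellDepth Q k)))
        (ih (Nat.succ k) c (Nat.mul 2 m)) true) false) n

/-- The entry in row `i` and column `j` of the matrix with `P` rows and `Q` columns coded
by `m`. -/
def cell (P Q m i j : ℕ) : ℕ := bitOf m (Nat.sub (Nat.mul P Q) (Nat.succ (Nat.add (Nat.mul i Q) j)))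

/-- The number of ones in the `p × q` window at `(u, v)`. -/
def ones (P Q m u v p q : ℕ) : ℕ :=
  sumBelow (fun i => sumBelow (fun j => cell P Q m (Nat.add u i) (Nat.add v j)) q) p

/-- Whether the `p × q` window at `(u, v)` has entries `e` where `i + j ≤ c` and `1 - e`
elsewhere (columns are counted from the right if `r`). -/
def isLine (P Q m u v p q c e : ℕ) (r : Bool) : Bool :=
  allBelow (fun i => allBelow (fun j =>
    Nat.beq (cell P Q m (Nat.add u i) (Nat.add v j))
      (cond (Nat.ble (Nat.add i (cond r (Nat.sub q (Nat.succ j)) j)) c) e (Nat.sub 1 e))) q) p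

/-- `isLine` for some sign and orientation. -/
def isAnyLine (P Q m u v p q c : ℕ) : Bool :=
  or (or (isLine P Q m u v p q c 0 false) (isLine P Q m u v p q c 1 false))
    (or (isLine P Q m u v p q c 0 true) (isLine P Q m u v p q c 1 true))

/-- Whether some `4 × 5` or `5 × 4` window is split along its middle. -/
def hasLine (P Q m : ℕ) : Bool :=
  or (anyBelow (fun u => anyBelow (fun v => isAnyLine P Q m u v 4 5 3) (Nat.sub Q 4)) (Nat.sub P 3))
    (anyBelow (fun u => anyBelow (fun v => isAnyLine P Q m u v 5 4 3) (Nat.sub Q 3)) (Nat.sub P 4))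

/-- The facts about `5 × 5` matrices. -/
def fiveFacts (m : ℕ) : Bool :=
  -- A window of `N` cells with `x` ones has sum `2 * x - N`. The thresholds say that the sum is at
  -- least `5`, `4` and `6` in absolute value for `25`, `16` and `20` cells. The last clause moves a
  -- split `4 × 4` window one step along its antidiagonal.
  and (and (or (Nat.ble (ones 5 5 m 0 0 5 5) 10) (Nat.ble 15 (ones 5 5 m 0 0 5 5)))
    (allBelow (fun u => allBelow (fun v =>
      or (Nat.ble (ones 5 5 m u v 4 4) 6) (Nat.ble 10 (ones 5 5 m u v 4 4))) 2) 2))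
  (and (and
    (allBelow (fun u => or (or (Nat.ble (ones 5 5 m u 0 4 5) 7) (Nat.ble 13 (ones 5 5 m u 0 4 5)))
      (isAnyLine 5 5 m u 0 4 5 3)) 2)
    (allBelow (fun v => or (or (Nat.ble (ones 5 5 m 0 v 5 4) 7) (Nat.ble 13 (ones 5 5 m 0 v 5 4)))
      (isAnyLine 5 5 m 0 v 5 4 3)) 2))
    (or (not (isLine 5 5 m 1 0 4 4 3 0 false)) (isLine 5 5 m 0 1 4 4 3 0 false)))

-- With only `25` cells, the bound `26` never prunes: all `5 × 5` matrices without zero-sum squares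
-- are covered.
set_option maxRecDepth 100000 in
theorem search_five : search 5 26 fiveFacts 25 0 0 0 = true := by decide +kernel

-- Fewer than `18` ones and fewer than `18` zeros among `30` cells means a sum below `6` in absolute
-- value.
set_option maxRecDepth 100000 in
theorem search_five_six : search 6 18 (hasLine 5 6) 30 0 0 0 = true := by decide +kernel

-- The bound `27` covers sums below `18` in absolute value. This slack beyond `6` is what settles
-- the sizes from `6 × 7` to `7 × 8`.
set_option maxRecDepth 100000 in
theorem search_six : search 6 27 (hasLine 6 6) 36 0 0 0 = true := by decide +kernel

/-! ### Soundness of the search -/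

theorem sumBelow_eq (F : ℕ → ℕ) (n : ℕ) : sumBelow F n = ∑ i ∈ Finset.range n, F i := by
  induction n with
  | zero => rfl
  | succ n ih => rw [Finset.sum_range_succ, ← ih]; exact add_comm _ _

theorem allBelow_iff (F : ℕ → Bool) (n : ℕ) : allBelow F n = true ↔ ∀ i < n, F i = true := by
  induction n with
  | zero => simp [allBelow]
  | succ n ih =>
    have h : allBelow F (n + 1) = (F n && allBelow F n) := rfl
    rw [h, Bool.and_eq_true, ih]
    refine ⟨fun ⟨h1, h2⟩ i hi => ?_, fun h => ⟨h n (by omega), fun i hi => h i (by omega)⟩⟩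
    rcases Nat.lt_succ_iff_lt_or_eq.mp hi with h | rfl
    exacts [h2 i h, h1]

theorem anyBelow_iff (F : ℕ → Bool) (n : ℕ) : anyBelow F n = true ↔ ∃ i < n, F i = true := by
  induction n with
  | zero => simp [anyBelow]
  | succ n ih =>
    have h : anyBelow F (n + 1) = (F n || anyBelow F n) := rfl
    rw [h, Bool.or_eq_true, ih]
    constructor
    · rintro (h | ⟨i, hi, h⟩)
      exacts [⟨n, by omega, h⟩, ⟨i, by omega, h⟩]
    · rintro ⟨i, hi, hF⟩
      rcases Nat.lt_succ_iff_lt_or_eq.mp hi with h' | rfl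
      exacts [Or.inr ⟨i, h', hF⟩, Or.inl hF]

theorem bitOf_eq (m i : ℕ) : bitOf m i = m / 2 ^ i % 2 := by
  have : bitOf m i = (m >>> i) % 2 := rfl
  rw [this, Nat.shiftRight_eq_div_pow]

theorem bitOf_push_zero (m v : ℕ) (hv : v < 2) : bitOf (2 * m + v) 0 = v := by
  rw [bitOf_eq]; omega

theorem bitOf_push_succ (m v i : ℕ) (hv : v < 2) : bitOf (2 * m + v) (i + 1) = bitOf m i := by
  rw [bitOf_eq, bitOf_eq, pow_succ', ← Nat.div_div_eq_div_mul]
  congr 2; omega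

theorem cellDepth_eq (Q k : ℕ) : cellDepth Q k = min (k / Q) (k % Q) := by
  change cond (Nat.ble (k / Q) (k % Q)) (k / Q) (k % Q) = _
  cases h : Nat.ble (k / Q) (k % Q)
  · have : ¬ k / Q ≤ k % Q := fun h' => by rw [Nat.ble_eq_true_of_le h'] at h; cases h
    simp; omega
  · have := Nat.le_of_ble_eq_true h
    simp; omega

theorem cellFits_of_forall (m Q v t : ℕ)
    (h : ∀ d < t, bitOf m d + bitOf m ((d + 1) * Q - 1) + (v + bitOf m (d + (d + 1) * Q)) ≠ 2) :
    cellFits m Q v t = true := by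
  induction t with
  | zero => rfl
  | succ t ih =>
    change cond (Nat.beq (bitOf m t + bitOf m ((t + 1) * Q - 1) +
      (v + bitOf m (t + (t + 1) * Q))) 2) false (cellFits m Q v t) = true
    rw [ih fun d hd => h d (by omega)]
    cases h' : Nat.beq _ 2
    · rfl
    · exact absurd (Nat.eq_of_beq_eq_true h') (h t (by omega))

theorem ble_false_of_lt {a b : ℕ} (h : b < a) : Nat.ble a b = false := by
  cases h' : Nat.ble a b
  · rfl
  · have := Nat.le_of_ble_eq_true h'; omega

/-- The branch that follows `g` is never cut: its entries fit by `hfit`, and `h1` and `h0` keep its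
numbers of ones and of zeros below `h`. It therefore ends in a leaf that codes `g`, where `R` was
tested. -/
theorem search_sound (Q h N : ℕ) (R : ℕ → Bool) (g : ℕ → ℕ) (hQ : 0 < Q) (hg : ∀ k, g k < 2)
    (hfit : ∀ k < N, ∀ d < min (k / Q) (k % Q),
      g (k - (d + 1)) + g (k - (d + 1) * Q) + (g k + g (k - (d + 1) * Q - (d + 1))) ≠ 2)
    (h1 : ∑ i ∈ Finset.range N, g i < h) (h0 : N < h + ∑ i ∈ Finset.range N, g i)
    (n : ℕ) : ∀ k c m, k + n = N → c = ∑ i ∈ Finset.range k, g i →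
      (∀ t < k, bitOf m t = g (k - 1 - t)) → search Q h R n k c m = true →
      ∃ m', (∀ t < N, bitOf m' t = g (N - 1 - t)) ∧ R m' = true := by
  induction n with
  | zero =>
    intro k c m hk _ hm hs
    obtain rfl : k = N := hk
    exact ⟨m, hm, hs⟩
  | succ n ih =>
    intro k c m hk hc hm hs
    have hle : ∑ i ∈ Finset.range N, g i ≤ ∑ i ∈ Finset.range (k + 1), g i + n := by
      rw [show N = (k + 1) + n by omega, Finset.sum_range_add]
      have : ∑ x ∈ Finset.range n, g (k + 1 + x) ≤ ∑ x ∈ Finset.range n, 1 :=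
        Finset.sum_le_sum fun i _ => by have := hg (k + 1 + i); omega
      simp at this
      omega
    have hge : ∑ i ∈ Finset.range (k + 1), g i ≤ ∑ i ∈ Finset.range N, g i :=
      Finset.sum_le_sum_of_subset (by simp; omega)
    rw [Finset.sum_range_succ] at hle hge
    have hf : cellFits m Q (g k) (cellDepth Q k) = true := by
      rw [cellDepth_eq]
      refine cellFits_of_forall _ _ _ _ fun d hd => ?_
      have hd1 : (d + 1) * Q ≤ k / Q * Q := Nat.mul_le_mul_right _ (by omega)
      have hd2 := Nat.div_add_mod' k Q
      have hd3 : 0 < (d + 1) * Q := by positivity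
      have := hfit k (by omega) d hd
      rw [hm _ (by omega), hm _ (by omega), hm _ (by omega)]
      rwa [show k - 1 - d = k - (d + 1) by omega,
        show k - 1 - ((d + 1) * Q - 1) = k - (d + 1) * Q by omega,
        show k - 1 - (d + (d + 1) * Q) = k - (d + 1) * Q - (d + 1) by omega]
    have hs' : cond (cond (cond (Nat.ble h (c + 1)) false (cellFits m Q 1 (cellDepth Q k)))
        (search Q h R n (k + 1) (c + 1) (2 * m + 1)) true)
      (cond (cond (Nat.ble h (k - c + 1)) false (cellFits m Q 0 (cellDepth Q k)))
        (search Q h R n (k + 1) c (2 * m)) true) false = true := hs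
    have key : search Q h R n (k + 1) (c + g k) (2 * m + g k) = true := by
      rcases (show g k = 0 ∨ g k = 1 by have := hg k; omega) with hk' | hk'
      · rw [hk'] at hf hle ⊢
        rw [hf, ble_false_of_lt (a := h) (b := k - c + 1) (by omega)] at hs'
        revert hs'
        cases cond (cond (Nat.ble h (c + 1)) false (cellFits m Q 1 (cellDepth Q k)))
          (search Q h R n (k + 1) (c + 1) (2 * m + 1)) true
        · simp
        · simp
      · rw [hk'] at hf hge ⊢
        rw [hf, ble_false_of_lt (a := h) (b := c + 1) (by omega)] at hs'
        revert hs'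
        cases search Q h R n (k + 1) (c + 1) (2 * m + 1) <;> simp
    refine ih (k + 1) _ _ (by omega) (by rw [Finset.sum_range_succ, ← hc]) ?_ key
    intro t ht
    rcases t with _ | t
    · rw [bitOf_push_zero _ _ (hg k)]; rfl
    · rw [bitOf_push_succ _ _ _ (hg k), hm t (by omega)]
      congr 1; omega

/-- A matrix of signs without zero-sum squares in its upper left `p × q` corner. -/
def CornerFree (F : ℕ → ℕ → ℤ) (p q : ℕ) : Prop :=
  ∀ i j s, 0 < s → i + s < p → j + s < q →
    F i j + F i (j + s) + F (i + s) j + F (i + s) (j + s) ≠ 0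

/-- The digit that codes a sign. -/
def digit (x : ℤ) : ℕ := if x = 1 then 1 else 0

theorem digit_lt (x : ℤ) : digit x < 2 := by unfold digit; split <;> omega

theorem eq_digit {x : ℤ} (hx : x = 1 ∨ x = -1) : x = 2 * (digit x : ℤ) - 1 := by
  rcases hx with rfl | rfl <;> simp [digit]

theorem sum_digit (F : ℕ → ℕ → ℤ) (P Q : ℕ) (hQ : 0 < Q) :
    ∑ t ∈ Finset.range (P * Q), digit (F (t / Q) (t % Q)) =
      ∑ i ∈ Finset.range P, ∑ j ∈ Finset.range Q, digit (F i j) := by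
  induction P with
  | zero => simp
  | succ P ih =>
    rw [Nat.succ_mul, Finset.sum_range_add, ih, Finset.sum_range_succ]
    congr 1
    refine Finset.sum_congr rfl fun j hj => ?_
    have hj := Finset.mem_range.mp hj
    rw [mul_comm P Q, Nat.mul_add_div hQ, Nat.mul_add_mod, Nat.div_eq_of_lt hj,
      Nat.mod_eq_of_lt hj, add_zero]

theorem sum_eq_digit {F : ℕ → ℕ → ℤ} (hF : ∀ i j, F i j = 1 ∨ F i j = -1) (u v p q : ℕ) :
    ∑ i ∈ Finset.range p, ∑ j ∈ Finset.range q, F (u + i) (v + j) =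
      2 * (∑ i ∈ Finset.range p, ∑ j ∈ Finset.range q, digit (F (u + i) (v + j)) : ℕ) -
        (p * q : ℕ) := by
  rw [Finset.sum_congr rfl fun i _ => Finset.sum_congr rfl fun j _ => eq_digit (hF (u + i) (v + j))]
  simp [Finset.sum_sub_distrib, ← Finset.mul_sum]

/-- The bound on the sum says exactly that fewer than `h` entries are `1` and fewer than `h` are
`-1`. -/
theorem exists_code {F : ℕ → ℕ → ℤ} (hF : ∀ i j, F i j = 1 ∨ F i j = -1) {P Q h : ℕ}
    {R : ℕ → Bool} (hQ : 0 < Q) (hZ : CornerFree F P Q)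
    (hs : search Q h R (P * Q) 0 0 0 = true)
    (h1 : |∑ i ∈ Finset.range P, ∑ j ∈ Finset.range Q, F i j| < 2 * (h : ℤ) - (P * Q : ℕ)) :
    ∃ m, (∀ i < P, ∀ j < Q, cell P Q m i j = digit (F i j)) ∧ R m = true := by
  have hsum := sum_eq_digit hF 0 0 P Q
  simp only [zero_add] at hsum
  rw [hsum, ← sum_digit F P Q hQ, abs_lt] at h1
  have hfit : ∀ k < P * Q, ∀ d < min (k / Q) (k % Q),
      digit (F ((k - (d + 1)) / Q) ((k - (d + 1)) % Q)) +
        digit (F ((k - (d + 1) * Q) / Q) ((k - (d + 1) * Q) % Q)) +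
        (digit (F (k / Q) (k % Q)) + digit (F ((k - (d + 1) * Q - (d + 1)) / Q)
          ((k - (d + 1) * Q - (d + 1)) % Q))) ≠ 2 := by
    intro k hk d hd heq
    have hP : k / Q < P := Nat.div_lt_of_lt_mul (by rwa [mul_comm])
    have hQ' := Nat.mod_lt k hQ
    set i := k / Q with hi
    set j := k % Q with hj
    have hij : k = Q * i + j := (Nat.div_add_mod k Q).symm
    have hdm : ∀ a b, b < Q → (Q * a + b) / Q = a ∧ (Q * a + b) % Q = b := fun a b hb => by
      rw [Nat.mul_add_div hQ, Nat.mul_add_mod, Nat.div_eq_of_lt hb, Nat.mod_eq_of_lt hb, add_zero]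
      exact ⟨rfl, rfl⟩
    obtain ⟨i', hi'⟩ : ∃ i', i = i' + (d + 1) := ⟨i - (d + 1), by omega⟩
    obtain ⟨j', hj'⟩ : ∃ j', j = j' + (d + 1) := ⟨j - (d + 1), by omega⟩
    have e1 : k - (d + 1) = Q * i + j' := by omega
    have e2 : k - (d + 1) * Q = Q * i' + j := by
      rw [hij, hi', Nat.mul_add, mul_comm (d + 1) Q]; omega
    have e3 : Q * i' + j - (d + 1) = Q * i' + j' := by omega
    simp only [e1, e2, e3, (hdm i j' (by omega)).1, (hdm i j' (by omega)).2,
      (hdm i' j (by omega)).1, (hdm i' j (by omega)).2, (hdm i' j' (by omega)).1,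
      (hdm i' j' (by omega)).2] at heq
    refine hZ i' j' (d + 1) (by omega) (by omega) (by omega) ?_
    rw [← hi', ← hj']
    have a1 := eq_digit (hF i j)
    have a2 := eq_digit (hF i j')
    have a3 := eq_digit (hF i' j)
    have a4 := eq_digit (hF i' j')
    omega
  obtain ⟨m, hm, hR⟩ := search_sound Q h (P * Q) R (fun t => digit (F (t / Q) (t % Q))) hQ
    (fun _ => digit_lt _) hfit (by omega) (by omega) (P * Q) 0 0 0 (by simp) (by simp)
    (by simp) hs
  refine ⟨m, fun i hi j hj => ?_, hR⟩
  have hlt : i * Q + j < P * Q := by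
    have : (i + 1) * Q ≤ P * Q := Nat.mul_le_mul_right _ hi
    rw [Nat.succ_mul] at this; omega
  change bitOf m (P * Q - (i * Q + j + 1)) = _
  rw [hm _ (by omega), show P * Q - 1 - (P * Q - (i * Q + j + 1)) = Q * i + j by
    rw [mul_comm Q i]; omega]
  simp only [Nat.mul_add_div hQ, Nat.mul_add_mod, Nat.div_eq_of_lt hj, Nat.mod_eq_of_lt hj,
    add_zero]

theorem ones_eq {F : ℕ → ℕ → ℤ} {P Q m : ℕ}
    (hm : ∀ i < P, ∀ j < Q, cell P Q m i j = digit (F i j)) {u v p q : ℕ} (hu : u + p ≤ P)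
    (hv : v + q ≤ Q) :
    ones P Q m u v p q =
      ∑ i ∈ Finset.range p, ∑ j ∈ Finset.range q, digit (F (u + i) (v + j)) := by
  unfold ones
  rw [sumBelow_eq]
  refine Finset.sum_congr rfl fun i hi => ?_
  rw [sumBelow_eq]
  refine Finset.sum_congr rfl fun j hj => ?_
  simp only [Finset.mem_range] at hi hj
  exact hm _ (by change u + i < P; omega) _ (by change v + j < Q; omega)

theorem isLine_iff {F : ℕ → ℕ → ℤ} (hF : ∀ i j, F i j = 1 ∨ F i j = -1) {P Q m : ℕ}
    (hm : ∀ i < P, ∀ j < Q, cell P Q m i j = digit (F i j)) {u v p q : ℕ} (hu : u + p ≤ P)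
    (hv : v + q ≤ Q) (c e : ℕ) (r : Bool) (he : e < 2) :
    isLine P Q m u v p q c e r = true ↔
      ∀ i < p, ∀ j < q, F (u + i) (v + j) =
        if i + (cond r (q - (j + 1)) j) ≤ c then 2 * (e : ℤ) - 1 else 1 - 2 * (e : ℤ) := by
  unfold isLine
  rw [allBelow_iff]
  refine forall₂_congr fun i hi => ?_
  rw [allBelow_iff]
  refine forall₂_congr fun j hj => ?_
  have h1 : cell P Q m (Nat.add u i) (Nat.add v j) = digit (F (u + i) (v + j)) :=
    hm _ (by change u + i < P; omega) _ (by change v + j < Q; omega)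
  rw [h1]
  have h2 := eq_digit (hF (u + i) (v + j))
  have h3 := digit_lt (F (u + i) (v + j))
  have h4 : ∀ a b : ℕ, Nat.beq a b = true ↔ a = b :=
    fun a b => ⟨Nat.eq_of_beq_eq_true, fun h => h ▸ Nat.beq_refl a⟩
  rw [h4]
  change _ = cond (Nat.ble (i + cond r (q - (j + 1)) j) c) e (1 - e) ↔ _
  split
  · rw [Nat.ble_eq_true_of_le ‹_›]
    simp only [cond_true]
    omega
  · rw [ble_false_of_lt (by omega)]
    simp only [cond_false]
    omega

/-! ### Rectangles of the integer plane -/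

/-- All values of `f` are signs. -/
def IsSign (f : ℤ → ℤ → ℤ) : Prop := ∀ i j, f i j = 1 ∨ f i j = -1

/-- `f` has no zero-sum square in the `p × q` rectangle with upper left cell `(a, b)`. -/
def SquareFreeOn (f : ℤ → ℤ → ℤ) (a b : ℤ) (p q : ℕ) : Prop :=
  ∀ i j s : ℤ, 0 < s → a ≤ i → i + s < a + p → b ≤ j → j + s < b + q →
    f i j + f i (j + s) + f (i + s) j + f (i + s) (j + s) ≠ 0

/-- The sum of `f` over the `p × q` rectangle with upper left cell `(a, b)`. -/
def rectSum (f : ℤ → ℤ → ℤ) (a b : ℤ) (p q : ℕ) : ℤ :=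
  ∑ i ∈ Finset.range p, ∑ j ∈ Finset.range q, f (a + i) (b + j)

/-- On the rectangle, `f` is `-1` up to the antidiagonal `i + j = c` and `1` after it. -/
def SplitAt (f : ℤ → ℤ → ℤ) (c a b : ℤ) (p q : ℕ) : Prop :=
  ∀ i j : ℤ, a ≤ i → i < a + p → b ≤ j → j < b + q → f i j = if i + j ≤ c then -1 else 1

/-- The rectangle is split by an antidiagonal that passes through its centre. -/
def MidSplit (f : ℤ → ℤ → ℤ) (a b : ℤ) (p q : ℕ) : Prop :=
  -- The cut runs at `i + j = c + 1 / 2`, while the centre has `i + j = a + b + (p + q - 2) / 2`.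
  ∃ c : ℤ, 2 * (c - a - b) + 3 = p + q ∧ SplitAt f c a b p q

/-- The reflection of `f` that reverses the columns. -/
def flipCols (f : ℤ → ℤ → ℤ) : ℤ → ℤ → ℤ := fun i j => f i (-j)

/-- `MidSplit` for some choice of sign and orientation. -/
def AnyMidSplit (f : ℤ → ℤ → ℤ) (a b : ℤ) (p q : ℕ) : Prop :=
  (MidSplit f a b p q ∨ MidSplit (-f) a b p q) ∨
    -- Negation takes the columns `b, …, b + q - 1` to `1 - b - q, …, -b`.
    (MidSplit (flipCols f) a (1 - b - q) p q ∨ MidSplit (-flipCols f) a (1 - b - q) p q)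

theorem IsSign.neg {f : ℤ → ℤ → ℤ} (hf : IsSign f) : IsSign (-f) := fun i j => by
  rcases hf i j with h | h <;> simp [h]

theorem IsSign.flipCols {f : ℤ → ℤ → ℤ} (hf : IsSign f) : IsSign (flipCols f) :=
  fun i j => hf i (-j)

theorem SquareFreeOn.neg {f : ℤ → ℤ → ℤ} {a b : ℤ} {p q : ℕ} (h : SquareFreeOn f a b p q) :
    SquareFreeOn (-f) a b p q := fun i j s hs h1 h2 h3 h4 h5 =>
  h i j s hs h1 h2 h3 h4 (by simp only [Pi.neg_apply] at h5; omega)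

theorem SquareFreeOn.flipCols {f : ℤ → ℤ → ℤ} {a b : ℤ} {p q : ℕ} (h : SquareFreeOn f a b p q) :
    SquareFreeOn (flipCols f) a (1 - b - q) p q := fun i j s hs h1 h2 h3 h4 h5 => by
  refine h i (-(j + s)) s hs h1 h2 (by omega) (by omega) ?_
  rw [show -(j + s) + s = -j by ring]
  simp only [_root_.flipCols] at h5
  omega

theorem SquareFreeOn.swap {f : ℤ → ℤ → ℤ} {a b : ℤ} {p q : ℕ} (h : SquareFreeOn f a b p q) :
    SquareFreeOn (fun i j => f j i) b a q p := fun i j s hs h1 h2 h3 h4 h5 =>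
  h j i s hs h3 h4 h1 h2 (by dsimp only at h5; omega)

theorem SquareFreeOn.mono {f : ℤ → ℤ → ℤ} {a b a' b' : ℤ} {p q p' q' : ℕ}
    (h : SquareFreeOn f a b p q) (ha : a ≤ a') (hp : a' + p' ≤ a + p) (hb : b ≤ b')
    (hq : b' + q' ≤ b + q) : SquareFreeOn f a' b' p' q' := fun i j s hs h1 h2 h3 h4 =>
  h i j s hs (by omega) (by omega) (by omega) (by omega)

theorem rectSum_neg (f : ℤ → ℤ → ℤ) (a b : ℤ) (p q : ℕ) :
    rectSum (-f) a b p q = -rectSum f a b p q := by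
  simp [rectSum]

theorem rectSum_flipCols (f : ℤ → ℤ → ℤ) (a b : ℤ) (p q : ℕ) :
    rectSum (flipCols f) a (1 - b - q) p q = rectSum f a b p q := by
  refine Finset.sum_congr rfl fun i _ => ?_
  rw [← Finset.sum_range_reflect]
  refine Finset.sum_congr rfl fun j hj => ?_
  have := Finset.mem_range.mp hj
  simp only [flipCols]
  congr 1
  omega

theorem rectSum_swap (f : ℤ → ℤ → ℤ) (a b : ℤ) (p q : ℕ) :
    rectSum (fun i j => f j i) b a q p = rectSum f a b p q := by
  unfold rectSum
  rw [Finset.sum_comm]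

/-- The centre equation has an odd left side, and the right side is `2 * p`. -/
theorem not_midSplit_square (f : ℤ → ℤ → ℤ) (a b : ℤ) (p : ℕ) : ¬ MidSplit f a b p p := by
  rintro ⟨c, hc, -⟩
  omega

theorem not_anyMidSplit_square (f : ℤ → ℤ → ℤ) (a b : ℤ) (p : ℕ) :
    ¬ AnyMidSplit f a b p p := by
  rintro ((h | h) | (h | h)) <;> exact not_midSplit_square _ _ _ _ h

theorem MidSplit.swap {f : ℤ → ℤ → ℤ} {a b : ℤ} {p q : ℕ} (h : MidSplit f a b p q) :
    MidSplit (fun i j => f j i) b a q p := by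
  obtain ⟨c, hc, h⟩ := h
  refine ⟨c, by omega, fun i j h1 h2 h3 h4 => ?_⟩
  change f j i = _
  rw [h j i h3 h4 h1 h2, add_comm]

/-- For a reflected function, transposition also reverses the colours. -/
theorem MidSplit.swap_flipCols {f : ℤ → ℤ → ℤ} {a b : ℤ} {p q : ℕ}
    (h : MidSplit (flipCols f) a (1 - b - q) p q) :
    MidSplit (-flipCols fun i j => f j i) b (1 - a - p) q p := by
  obtain ⟨c, hc, h⟩ := h
  refine ⟨-c - 1, by omega, fun i j h1 h2 h3 h4 => ?_⟩
  have := h (-j) (-i) (by omega) (by omega) (by omega) (by omega)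
  simp only [flipCols, neg_neg, Pi.neg_apply] at this ⊢
  rw [this]
  split <;> split <;> omega

theorem AnyMidSplit.swap {f : ℤ → ℤ → ℤ} {a b : ℤ} {p q : ℕ} (h : AnyMidSplit f a b p q) :
    AnyMidSplit (fun i j => f j i) b a q p := by
  rcases h with (h | h) | (h | h)
  · exact Or.inl (Or.inl h.swap)
  · exact Or.inl (Or.inr h.swap)
  · exact Or.inr (Or.inr h.swap_flipCols)
  · have : MidSplit (flipCols (-f)) a (1 - b - q) p q := h
    have := this.swap_flipCols
    refine Or.inr (Or.inl ?_)
    convert this using 1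
    funext i j
    simp [flipCols]

/-- Some `4 × 5` or `5 × 4` window is split through its centre. -/
def HasMidSplit (f : ℤ → ℤ → ℤ) (a b : ℤ) (p q : ℕ) : Prop :=
  ∃ (u v : ℤ) (p' q' : ℕ), (p' = 4 ∧ q' = 5 ∨ p' = 5 ∧ q' = 4) ∧ a ≤ u ∧ u + p' ≤ a + p ∧
    b ≤ v ∧ v + q' ≤ b + q ∧ AnyMidSplit f u v p' q'

section Code
variable {f : ℤ → ℤ → ℤ} (hf : IsSign f) {a b : ℤ} {P Q : ℕ}
include hf

theorem exists_rect_code {h : ℕ} {R : ℕ → Bool} (hQ : 0 < Q) (hZ : SquareFreeOn f a b P Q)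
    (hs : search Q h R (P * Q) 0 0 0 = true)
    (h1 : |rectSum f a b P Q| < 2 * (h : ℤ) - (P * Q : ℕ)) :
    ∃ m, (∀ i < P, ∀ j < Q, cell P Q m i j = digit (f (a + i) (b + j))) ∧ R m = true := by
  refine exists_code (F := fun i j : ℕ => f (a + i) (b + j)) (fun i j => hf _ _) hQ ?_ hs h1
  intro i j s hs hi hj h0
  refine hZ (a + i) (b + j) s (by omega) (by omega) (by omega) (by omega) (by omega) ?_
  push_cast at h0
  simpa only [add_assoc] using h0

theorem rectSum_eq_ones {m : ℕ}
    (hm : ∀ i < P, ∀ j < Q, cell P Q m i j = digit (f (a + i) (b + j))) {u v p q : ℕ}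
    (hu : u + p ≤ P) (hv : v + q ≤ Q) :
    rectSum f (a + u) (b + v) p q = 2 * (ones P Q m u v p q : ℤ) - (p * q : ℕ) := by
  rw [ones_eq (F := fun i j : ℕ => f (a + i) (b + j)) hm hu hv,
    ← sum_eq_digit (F := fun i j : ℕ => f (a + i) (b + j)) (fun i j => hf _ _)]
  refine Finset.sum_congr rfl fun i _ => Finset.sum_congr rfl fun j _ => ?_
  push_cast
  rw [add_assoc, add_assoc]

theorem isLine_iff_rect {m : ℕ}
    (hm : ∀ i < P, ∀ j < Q, cell P Q m i j = digit (f (a + i) (b + j))) {u v p q : ℕ}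
    (hu : u + p ≤ P) (hv : v + q ≤ Q) (c : ℕ) :
    isLine P Q m u v p q c 0 false = true ↔
      SplitAt f (c + (a + u) + (b + v)) (a + u) (b + v) p q := by
  rw [isLine_iff (F := fun i j : ℕ => f (a + i) (b + j)) (fun i j => hf _ _) hm hu hv _ _ _
    (by omega)]
  constructor
  · intro h i j h1 h2 h3 h4
    have := h (i - (a + u)).toNat (by omega) (j - (b + v)).toNat (by omega)
    simp only [cond_false] at this
    rw [show a + ((u + (i - (a + u)).toNat : ℕ) : ℤ) = i by omega,
      show b + ((v + (j - (b + v)).toNat : ℕ) : ℤ) = j by omega] at this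
    rw [this]
    split <;> split <;> omega
  · intro h i hi j hj
    have := h (a + u + i) (b + v + j) (by omega) (by omega) (by omega) (by omega)
    simp only [cond_false]
    push_cast
    rw [← add_assoc, ← add_assoc, this]
    split <;> split <;> omega

theorem anyMidSplit_of_isAnyLine {m : ℕ}
    (hm : ∀ i < P, ∀ j < Q, cell P Q m i j = digit (f (a + i) (b + j))) {u v p q c : ℕ}
    (hu : u + p ≤ P) (hv : v + q ≤ Q) (hc : 2 * c + 3 = p + q)
    (h : isAnyLine P Q m u v p q c = true) : AnyMidSplit f (a + u) (b + v) p q := by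
  have key : ∀ e r, e < 2 → isLine P Q m u v p q c e r = true → ∀ i < p, ∀ j < q,
      f (a + (u + i : ℕ)) (b + (v + j : ℕ)) =
        if i + (cond r (q - (j + 1)) j) ≤ c then 2 * (e : ℤ) - 1 else 1 - 2 * (e : ℤ) :=
    fun e r he hl => (isLine_iff (F := fun i j : ℕ => f (a + i) (b + j)) (fun i j => hf _ _) hm
      hu hv c e r he).mp hl
  have h' : (isLine P Q m u v p q c 0 false || isLine P Q m u v p q c 1 false ||
    (isLine P Q m u v p q c 0 true || isLine P Q m u v p q c 1 true)) = true := h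
  simp only [Bool.or_eq_true] at h'
  rcases h' with (h | h) | (h | h)
  · exact Or.inl (Or.inl ⟨_, by omega, (isLine_iff_rect hf hm hu hv c).mp h⟩)
  · refine Or.inl (Or.inr ⟨c + (a + u) + (b + v), by omega, fun i j h1 h2 h3 h4 => ?_⟩)
    have := key 1 false (by omega) h (i - (a + u)).toNat (by omega) (j - (b + v)).toNat (by omega)
    rw [show a + ((u + (i - (a + u)).toNat : ℕ) : ℤ) = i by omega,
      show b + ((v + (j - (b + v)).toNat : ℕ) : ℤ) = j by omega] at this
    simp only [Pi.neg_apply, this, cond_false]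
    split <;> split <;> omega
  · refine Or.inr (Or.inl ⟨c + (a + u) + (1 - (b + v) - q), by omega, fun i j h1 h2 h3 h4 => ?_⟩)
    have := key 0 true (by omega) h (i - (a + u)).toNat (by omega) (-j - (b + v)).toNat (by omega)
    rw [show a + ((u + (i - (a + u)).toNat : ℕ) : ℤ) = i by omega,
      show b + ((v + (-j - (b + v)).toNat : ℕ) : ℤ) = -j by omega] at this
    simp only [flipCols, this, cond_true]
    split <;> split <;> omega
  · refine Or.inr (Or.inr ⟨c + (a + u) + (1 - (b + v) - q), by omega, fun i j h1 h2 h3 h4 => ?_⟩)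
    have := key 1 true (by omega) h (i - (a + u)).toNat (by omega) (-j - (b + v)).toNat (by omega)
    rw [show a + ((u + (i - (a + u)).toNat : ℕ) : ℤ) = i by omega,
      show b + ((v + (-j - (b + v)).toNat : ℕ) : ℤ) = -j by omega] at this
    simp only [Pi.neg_apply, flipCols, this, cond_true]
    split <;> split <;> omega

theorem hasMidSplit_of_hasLine {m : ℕ}
    (hm : ∀ i < P, ∀ j < Q, cell P Q m i j = digit (f (a + i) (b + j)))
    (h : hasLine P Q m = true) : HasMidSplit f a b P Q := by
  rw [hasLine, Bool.or_eq_true] at h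
  simp only [anyBelow_iff] at h
  rcases h with ⟨u, hu, v, hv, h⟩ | ⟨u, hu, v, hv, h⟩
  · have hu : u < P - 3 := hu
    have hv : v < Q - 4 := hv
    exact ⟨a + u, b + v, 4, 5, Or.inl ⟨rfl, rfl⟩, by omega, by omega, by omega, by omega,
      anyMidSplit_of_isAnyLine hf hm (by omega) (by omega) rfl h⟩
  · have hu : u < P - 4 := hu
    have hv : v < Q - 3 := hv
    exact ⟨a + u, b + v, 5, 4, Or.inr ⟨rfl, rfl⟩, by omega, by omega, by omega, by omega,
      anyMidSplit_of_isAnyLine hf hm (by omega) (by omega) rfl h⟩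

end Code

/-! ### Small matrices without zero-sum squares -/

theorem fiveFacts_iff (m : ℕ) : fiveFacts m = true ↔
    ((ones 5 5 m 0 0 5 5 ≤ 10 ∨ 15 ≤ ones 5 5 m 0 0 5 5) ∧
      ∀ u < 2, ∀ v < 2, ones 5 5 m u v 4 4 ≤ 6 ∨ 10 ≤ ones 5 5 m u v 4 4) ∧
    ((∀ u < 2, (ones 5 5 m u 0 4 5 ≤ 7 ∨ 13 ≤ ones 5 5 m u 0 4 5) ∨
        isAnyLine 5 5 m u 0 4 5 3 = true) ∧
      ∀ v < 2, (ones 5 5 m 0 v 5 4 ≤ 7 ∨ 13 ≤ ones 5 5 m 0 v 5 4) ∨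
        isAnyLine 5 5 m 0 v 5 4 3 = true) ∧
    (isLine 5 5 m 1 0 4 4 3 0 false = true → isLine 5 5 m 0 1 4 4 3 0 false = true) := by
  have hble : ∀ a b : ℕ, Nat.ble a b = true ↔ a ≤ b := fun a b => by rw [Nat.ble_eq]
  unfold fiveFacts
  simp only [Bool.and_eq_true, Bool.or_eq_true, allBelow_iff, hble, Bool.not_eq_true',
    ← Bool.not_eq_true, imp_iff_not_or]

section
variable {f : ℤ → ℤ → ℤ} (hf : IsSign f)
include hf

theorem exists_five_code {a b : ℤ} (hZ : SquareFreeOn f a b 5 5) :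
    ∃ m, (∀ i < 5, ∀ j < 5, cell 5 5 m i j = digit (f (a + i) (b + j))) ∧
      fiveFacts m = true := by
  have h5 : |rectSum f a b 5 5| ≤ 25 := by
    have := sum_eq_digit (F := fun i j : ℕ => f (a + i) (b + j)) (fun i j => hf _ _) 0 0 5 5
    simp only [zero_add] at this
    rw [rectSum, this]
    have h1 : ∑ i ∈ Finset.range 5, ∑ j ∈ Finset.range 5, digit (f (a + i) (b + j)) ≤
        ∑ i ∈ Finset.range 5, ∑ j ∈ Finset.range 5, 1 :=
      Finset.sum_le_sum fun i _ => Finset.sum_le_sum fun j _ => by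
        have := digit_lt (f (a + i) (b + j)); omega
    simp only [Finset.sum_const, Finset.card_range, smul_eq_mul] at h1
    rw [abs_le]
    omega
  exact exists_rect_code hf (by omega) hZ search_five (by norm_num; omega)

theorem five_le_abs_rectSum_five {a b : ℤ} (hZ : SquareFreeOn f a b 5 5) :
    5 ≤ |rectSum f a b 5 5| := by
  obtain ⟨m, hm, h⟩ := exists_five_code hf hZ
  have h1 := ((fiveFacts_iff m).mp h).1.1
  have h2 := rectSum_eq_ones hf hm (u := 0) (v := 0) (p := 5) (q := 5) (by omega) (by omega)
  simp only [Nat.cast_zero, add_zero] at h2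
  rw [h2, le_abs]
  omega

/-- The bound was checked only for windows of a `5 × 5` matrix, so the window is enlarged by one row
and one column, each on a side where there is room. -/
theorem four_le_abs_rectSum_four {a b : ℤ} {p q : ℕ} (hZ : SquareFreeOn f a b p q) (hp : 5 ≤ p)
    (hq : 5 ≤ q) {u v : ℤ} (hu : a ≤ u) (hu' : u + 4 ≤ a + p) (hv : b ≤ v)
    (hv' : v + 4 ≤ b + q) : 4 ≤ |rectSum f u v 4 4| := by
  obtain ⟨x, u', hx, hxu, h1, h2⟩ : ∃ (x : ℕ) (u' : ℤ), x < 2 ∧ u' + x = u ∧ a ≤ u' ∧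
      u' + 5 ≤ a + p := by
    by_cases h : u + 5 ≤ a + p
    exacts [⟨0, u, by omega, by simp, hu, h⟩, ⟨1, u - 1, by omega, by simp, by omega, by omega⟩]
  obtain ⟨y, v', hy, hyv, h3, h4⟩ : ∃ (y : ℕ) (v' : ℤ), y < 2 ∧ v' + y = v ∧ b ≤ v' ∧
      v' + 5 ≤ b + q := by
    by_cases h : v + 5 ≤ b + q
    exacts [⟨0, v, by omega, by simp, hv, h⟩, ⟨1, v - 1, by omega, by simp, by omega, by omega⟩]
  obtain ⟨m, hm, h⟩ := exists_five_code hf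
    (hZ.mono (a' := u') (b' := v') (p' := 5) (q' := 5) h1 (by omega) h3 (by omega))
  have h5 := ((fiveFacts_iff m).mp h).1.2 x hx y hy
  have h6 := rectSum_eq_ones hf hm (u := x) (v := y) (p := 4) (q := 4) (by omega) (by omega)
  rw [hxu, hyv] at h6
  rw [h6, le_abs]
  omega

theorem anyMidSplit_four_five {a b : ℤ} {p q : ℕ} (hZ : SquareFreeOn f a b p q) (hp : 5 ≤ p)
    {u v : ℤ} (hu : a ≤ u) (hu' : u + 4 ≤ a + p) (hv : b ≤ v)
    (hv' : v + 5 ≤ b + q) (hs : |rectSum f u v 4 5| < 5) : AnyMidSplit f u v 4 5 := by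
  obtain ⟨x, u', hx, hxu, h1, h2⟩ : ∃ (x : ℕ) (u' : ℤ), x < 2 ∧ u' + x = u ∧ a ≤ u' ∧
      u' + 5 ≤ a + p := by
    by_cases h : u + 5 ≤ a + p
    exacts [⟨0, u, by omega, by simp, hu, h⟩, ⟨1, u - 1, by omega, by simp, by omega, by omega⟩]
  obtain ⟨m, hm, h⟩ := exists_five_code hf
    (hZ.mono (a' := u') (b' := v) (p' := 5) (q' := 5) h1 (by omega) hv (by omega))
  have h5 := ((fiveFacts_iff m).mp h).2.1.1 x hx
  have h6 := rectSum_eq_ones hf hm (u := x) (v := 0) (p := 4) (q := 5) (by omega) (by omega)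
  have h7 := anyMidSplit_of_isAnyLine hf hm (u := x) (v := 0) (p := 4) (q := 5) (c := 3)
    (by omega) (by omega) rfl
  simp only [hxu, Nat.cast_zero, add_zero] at h6 h7
  rw [h6, abs_lt] at hs
  exact h7 (h5.resolve_left (by omega))

theorem anyMidSplit_five_four {a b : ℤ} {p q : ℕ} (hZ : SquareFreeOn f a b p q) (hq : 5 ≤ q)
    {u v : ℤ} (hu : a ≤ u) (hu' : u + 5 ≤ a + p) (hv : b ≤ v)
    (hv' : v + 4 ≤ b + q) (hs : |rectSum f u v 5 4| < 5) : AnyMidSplit f u v 5 4 := by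
  obtain ⟨y, v', hy, hyv, h3, h4⟩ : ∃ (y : ℕ) (v' : ℤ), y < 2 ∧ v' + y = v ∧ b ≤ v' ∧
      v' + 5 ≤ b + q := by
    by_cases h : v + 5 ≤ b + q
    exacts [⟨0, v, by omega, by simp, hv, h⟩, ⟨1, v - 1, by omega, by simp, by omega, by omega⟩]
  obtain ⟨m, hm, h⟩ := exists_five_code hf
    (hZ.mono (a' := u) (b' := v') (p' := 5) (q' := 5) hu (by omega) h3 (by omega))
  have h5 := ((fiveFacts_iff m).mp h).2.1.2 y hy
  have h6 := rectSum_eq_ones hf hm (u := 0) (v := y) (p := 5) (q := 4) (by omega) (by omega)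
  have h7 := anyMidSplit_of_isAnyLine hf hm (u := 0) (v := y) (p := 5) (q := 4) (c := 3)
    (by omega) (by omega) rfl
  simp only [hyv, Nat.cast_zero, add_zero] at h6 h7
  rw [h6, abs_lt] at hs
  exact h7 (h5.resolve_left (by omega))

/-- A split `4 × 4` window can be moved along its antidiagonal. -/
theorem SplitAt.shift_four {u v : ℤ} (hZ : SquareFreeOn f (u - 1) v 5 5)
    (h : SplitAt f (u + v + 3) u v 4 4) : SplitAt f (u + v + 3) (u - 1) (v + 1) 4 4 := by
  obtain ⟨m, hm, hm'⟩ := exists_five_code hf hZ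
  have h1 := (isLine_iff_rect hf hm (u := 1) (v := 0) (p := 4) (q := 4) (by omega) (by omega) 3).mpr
    (by convert h using 1 <;> push_cast <;> ring)
  have h2 := (isLine_iff_rect hf hm (u := 0) (v := 1) (p := 4) (q := 4) (by omega) (by omega) 3).mp
    (((fiveFacts_iff m).mp hm').2.2 h1)
  convert h2 using 1 <;> push_cast <;> ring

theorem hasMidSplit_five_six {a b : ℤ} (hZ : SquareFreeOn f a b 5 6)
    (hs : |rectSum f a b 5 6| < 6) : HasMidSplit f a b 5 6 := by
  obtain ⟨m, hm, h⟩ := exists_rect_code hf (by omega) hZ search_five_six (by norm_num; omega)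
  exact hasMidSplit_of_hasLine hf hm h

theorem hasMidSplit_six_six {a b : ℤ} (hZ : SquareFreeOn f a b 6 6)
    (hs : |rectSum f a b 6 6| < 18) : HasMidSplit f a b 6 6 := by
  obtain ⟨m, hm, h⟩ := exists_rect_code hf (by omega) hZ search_six (by norm_num; omega)
  exact hasMidSplit_of_hasLine hf hm h

end

/-! ### A split corner forces a large sum -/

theorem CornerFree.ne {F : ℕ → ℕ → ℤ} {p q : ℕ} (h : CornerFree F p q) {i j i' j' : ℕ}
    (hi : i < i') (he : i' + j = i + j') (hp : i' < p) (hq : j' < q) :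
    F i j + F i j' + F i' j + F i' j' ≠ 0 := by
  have := h i j (i' - i) (by omega) (by omega) (by omega)
  rwa [show i + (i' - i) = i' by omega, show j + (i' - i) = j' by omega] at this

theorem CornerFree.swap {F : ℕ → ℕ → ℤ} {p q : ℕ} (h : CornerFree F p q) :
    CornerFree (fun i j => F j i) q p := fun i j s hs hi hj h0 =>
  h j i s hs hj hi (by dsimp only at h0; omega)

/-- The `d × d` corner is split by its antidiagonal. -/
def CornerSplit (F : ℕ → ℕ → ℤ) (d : ℕ) : Prop :=
  ∀ i < d, ∀ j < d, F i j = if i + j < d then -1 else 1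

theorem CornerSplit.swap {F : ℕ → ℕ → ℤ} {d : ℕ} (h : CornerSplit F d) :
    CornerSplit (fun i j => F j i) d := fun i hi j hj => by
  change F j i = _
  rw [h j hj i hi, add_comm]

theorem CornerSplit.eq_neg_one {F : ℕ → ℕ → ℤ} {d : ℕ} (h : CornerSplit F d) {i j : ℕ}
    (hij : i + j < d) : F i j = -1 := by
  rw [h i (by omega) j (by omega), if_pos hij]

/-- Entries in the column `k ≥ d` that are forced to be `1` by a split `d × d` corner. -/
def ColKnown (F : ℕ → ℕ → ℤ) (d k : ℕ) : Prop :=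
  (∀ i, 2 * i + k < 2 * d → F i k = 1) ∧ ∀ i, k < i + d → i ≤ d → F i k = 1

section
variable {F : ℕ → ℕ → ℤ} (hF : ∀ i j, F i j = 1 ∨ F i j = -1) {d p q : ℕ}
include hF

/-- A square hanging from the top row, with right side in column `d` and left side crossing the cut,
has opposite signs on the left; hence column `d` is constant. The two ones at the bottom of column
`d - 1` exclude the constant `-1`. -/
theorem CornerSplit.next_col (hd : 3 ≤ d) (hZ : CornerFree F p q) (h : CornerSplit F d)
    (hp : d ≤ p) (hq : d < q) : ∀ i < d, F i d = 1 := by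
  have hc : ∀ s, 0 < s → s < d → F 0 d = F s d := by
    intro s hs hsd
    have h1 := hZ.ne (i := 0) (j := d - s) (i' := s) (j' := d) hs (by omega) (by omega) hq
    rw [h.eq_neg_one (by omega), h s hsd (d - s) (by omega), if_neg (by omega)] at h1
    have := hF 0 d
    have := hF s d
    omega
  have h0 : F 0 d = 1 := by
    have h1 := hZ.ne (i := d - 2) (j := d - 1) (i' := d - 1) (j' := d) (by omega) (by omega)
      (by omega) hq
    rw [h (d - 2) (by omega) (d - 1) (by omega), h (d - 1) (by omega) (d - 1) (by omega),
      if_neg (by omega), if_neg (by omega), ← hc (d - 2) (by omega) (by omega),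
      ← hc (d - 1) (by omega) (by omega)] at h1
    have := hF 0 d
    omega
  intro i hi
  rcases Nat.eq_zero_or_pos i with rfl | hi0
  exacts [h0, hc i hi0 hi ▸ h0]

theorem CornerSplit.eq_one (hd : 3 ≤ d) (hZ : CornerFree F p q) (h : CornerSplit F d)
    (hp : d < p) (hq : d < q) {i j : ℕ} (hi : i ≤ d) (hj : j ≤ d) (hij : d ≤ i + j) :
    F i j = 1 := by
  have hcol := h.next_col hF hd hZ hp.le hq
  have hrow : ∀ j < d, F d j = 1 := h.swap.next_col (fun i j => hF j i) hd hZ.swap hq.le hp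
  rcases hi.lt_or_eq with hi | rfl
  · rcases hj.lt_or_eq with hj | rfl
    · rw [h i hi j hj, if_neg (by omega)]
    · exact hcol i hi
  · rcases hj.lt_or_eq with hj | rfl
    · exact hrow j hj
    · have h1 := hZ.ne (i := 0) (j := 0) (i' := j) (j' := j) (by omega) (by omega) hp hq
      rw [h.eq_neg_one (by omega), hcol 0 (by omega), hrow 0 (by omega)] at h1
      have := hF j j
      omega

/-- A square whose upper left cell is a `-1` of the corner and two of whose other cells are known to
be `1` has a `1` in its fourth cell. Once `F 0 k = 1`, this gives the lower entries of column `k`,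
and with `F d k = 1` the upper ones. If `F 0 k` were `-1`, similar squares would give two adjacent
`-1` in column `k` beside two `1` in column `k - 1`. -/
theorem colKnown_step (hd : 4 ≤ d) (hZ : CornerFree F p q) (h : CornerSplit F d)
    (hdp : d < p) (hdq : d < q) {k : ℕ} (hk : d < k) (hk2 : k < 2 * d) (hkp : k ≤ p)
    (hkq : k < q) (hC : ColKnown F d (k - 1))
    (hC' : d + 1 < k → ColKnown (fun i j => F j i) d (d + 1)) : ColKnown F d k := by
  have hone : ∀ {i j}, i ≤ d → j ≤ d → d ≤ i + j → F i j = 1 :=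
    fun hi hj hij => h.eq_one hF (by omega) hZ hdp hdq hi hj hij
  have h0 : F 0 k = 1 := by
    by_contra hne
    have h0 : F 0 k = -1 := (hF 0 k).resolve_left hne
    have hdk : F d k = -1 := by
      have h1 := hZ.ne (i := 0) (j := k - d) (i' := d) (j' := k) (by omega) (by omega) hdp hkq
      rw [h.eq_neg_one (by omega), h0, hone le_rfl (by omega) (by omega)] at h1
      have := hF d k
      omega
    -- For `k = 2 * d - 1` the square of side `d - 1` would start at `(0, d)`, past the `-1`
    -- entries, so row `d + 1` takes the place of row `d - 1`.
    rcases Nat.lt_or_ge k (2 * d - 1) with hlt | hge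
    · have h1 := hZ.ne (i := 0) (j := k - (d - 1)) (i' := d - 1) (j' := k) (by omega) (by omega)
        (by omega) hkq
      rw [h.eq_neg_one (by omega), h0, hone (by omega) (by omega) (by omega)] at h1
      have h2 := hZ.ne (i := d - 1) (j := k - 1) (i' := d) (j' := k) (by omega) (by omega) hdp hkq
      rw [hC.2 (d - 1) (by omega) (by omega), hC.2 d (by omega) le_rfl, hdk] at h2
      have := hF (d - 1) k
      omega
    · have hR := hC' (by omega)
      have h1 := hZ.ne (i := 0) (j := k - (d + 1)) (i' := d + 1) (j' := k) (by omega) (by omega)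
        (by omega) hkq
      rw [h.eq_neg_one (by omega), h0, show F (d + 1) (k - (d + 1)) = 1 from
        hR.2 _ (by omega) (by omega)] at h1
      have h2 := hZ.ne (i := 0) (j := d - 3) (i' := d + 1) (j' := k - 1) (by omega) (by omega)
        (by omega) (by omega)
      have h3 : F (d + 1) (d - 3) = 1 := by
        rcases Nat.lt_or_ge d 5 with h5 | h5
        exacts [hR.1 _ (by omega), hR.2 _ (by omega) (by omega)]
      rw [h.eq_neg_one (by omega), hC.1 0 (by omega), h3] at h2
      have h4 := hZ.ne (i := d) (j := k - 1) (i' := d + 1) (j' := k) (by omega) (by omega)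
        (by omega) hkq
      rw [hC.2 d (by omega) le_rfl, hdk] at h4
      have := hF (d + 1) k
      have := hF (d + 1) (k - 1)
      omega
  have hB : ∀ i, k < i + d → i ≤ d → F i k = 1 := by
    intro i hi hid
    have h1 := hZ.ne (i := 0) (j := k - i) (i' := i) (j' := k) (by omega) (by omega) (by omega) hkq
    rw [h.eq_neg_one (by omega), h0, hone hid (by omega) (by omega)] at h1
    have := hF i k
    omega
  refine ⟨fun i hi => ?_, hB⟩
  have h1 := hZ.ne (i := i) (j := i + k - d) (i' := d) (j' := k) (by omega) (by omega) hdp hkq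
  rw [h.eq_neg_one (by omega), hB d (by omega) le_rfl, hone le_rfl (by omega) (by omega)] at h1
  have := hF i k
  omega

/-- Columns and rows are treated together, because the column `2 * d - 1` needs the row `d + 1` and
conversely. -/
theorem colKnown (hd : 4 ≤ d) (hZ : CornerFree F p q) (h : CornerSplit F d)
    (hdp : d < p) (hdq : d < q) (k : ℕ) : d ≤ k → k < 2 * d →
    (k < q → k ≤ p → ColKnown F d k) ∧
      (k < p → k ≤ q → ColKnown (fun i j => F j i) d k) := by
  induction k using Nat.strong_induction_on with
  | _ k ih =>
    intro hk hk2
    rcases hk.eq_or_lt with rfl | hk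
    · have hone : ∀ {i j}, i ≤ d → j ≤ d → d ≤ i + j → F i j = 1 :=
        fun hi hj hij => h.eq_one hF (by omega) hZ hdp hdq hi hj hij
      exact ⟨fun _ _ => ⟨fun i hi => hone (by omega) le_rfl (by omega),
        fun i _ hi => hone hi le_rfl (by omega)⟩,
        fun _ _ => ⟨fun i hi => hone le_rfl (by omega) (by omega),
        fun i _ hi => hone le_rfl hi (by omega)⟩⟩
    · have h1 := ih (k - 1) (by omega) (by omega) (by omega)
      refine ⟨fun hq hp => ?_, fun hp hq => ?_⟩
      · exact colKnown_step hF hd hZ h hdp hdq hk hk2 hp hq (h1.1 (by omega) (by omega))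
          fun hdk => (ih (d + 1) hdk (by omega) (by omega)).2 (by omega) (by omega)
      · exact colKnown_step (fun i j => hF j i) hd hZ.swap h.swap hdq hdp hk hk2 hq hp
          (h1.2 (by omega) (by omega))
          fun hdk => (ih (d + 1) hdk (by omega) (by omega)).1 (by omega) (by omega)

/-- Two entries of column `k` at distance `k - d` have a nonnegative sum. -/
theorem pair_nonneg (hd : 4 ≤ d) (hZ : CornerFree F p q) (h : CornerSplit F d)
    (hdp : d < p) (hdq : d < q) {i i' k : ℕ} (hi : i < i') (hk : i' + d = i + k)
    (hi' : i' < 2 * d) (hip : i' < p) (hiq : i' ≤ q) (hkq : k < q) : 0 ≤ F i k + F i' k := by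
  have hcol : ∀ r ≤ i', F r d = 1 := by
    intro r hr
    rcases Nat.lt_or_ge d r with hdr | hdr
    · exact ((colKnown hF hd hZ h hdp hdq r hdr.le (by omega)).2 (by omega) (by omega)).2 d
        (by omega) le_rfl
    · exact h.eq_one hF (by omega) hZ hdp hdq hdr le_rfl (by omega)
  have h1 := hZ.ne (i := i) (j := d) (i' := i') (j' := k) hi (by omega) hip hkq
  rw [hcol i hi.le, hcol i' le_rfl] at h1
  have := hF i k
  have := hF i' k
  omega

/-- With `k = d + σ`, the first `2 * σ` entries of column `k` pair up at distance `σ` by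
`pair_nonneg`. The remaining `2 * d - k` entries are `1`, except perhaps the first of them, which
costs at most `2`. -/
theorem sum_col_ge (hd : 4 ≤ d) (hZ : CornerFree F p q) (h : CornerSplit F d)
    (hdp : d < p) (hdq : d < q) {k : ℕ} (hk : d < k) (hk2 : k ≤ 2 * d) (hkp : k ≤ p)
    (hkq : k < q) :
    (2 * d - k : ℤ) - 2 ≤ ∑ i ∈ Finset.range k, F i k ∧
      (2 * k ≤ 3 * d ∨ k = 2 * d → (2 * d - k : ℤ) ≤ ∑ i ∈ Finset.range k, F i k) := by
  obtain ⟨σ, rfl⟩ : ∃ σ, k = d + σ := ⟨k - d, by omega⟩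
  obtain ⟨t, ht⟩ : ∃ t, d = σ + t := ⟨d - σ, by omega⟩
  have hsplit : Finset.range (d + σ) = Finset.range (σ + σ + t) := by rw [ht]; congr 1; omega
  rw [hsplit, Finset.sum_range_add, Finset.sum_range_add, ← Finset.sum_add_distrib]
  have hpair : 0 ≤ ∑ i ∈ Finset.range σ, (F i (d + σ) + F (σ + i) (d + σ)) := by
    refine Finset.sum_nonneg fun i hi => ?_
    have := Finset.mem_range.mp hi
    exact pair_nonneg hF hd hZ h hdp hdq (by omega) (by omega) (by omega) (by omega) (by omega) hkq
  have hone : ∀ x < t, (2 * σ ≤ d ∨ 0 < x) → F (σ + σ + x) (d + σ) = 1 := by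
    intro x hx hx'
    have hK := (colKnown hF hd hZ h hdp hdq (d + σ) (by omega) (by omega)).1 hkq hkp
    -- Below row `d` the square is closed by an entry of row `2 * σ + x`, known only for `x > 0`.
    rcases Nat.lt_or_ge d (σ + σ + x) with hlt | hge
    · have hR := (colKnown hF hd hZ h hdp hdq (σ + σ + x) (by omega) (by omega)).2 (by omega)
        (by omega)
      have h1 := hZ.ne (i := 0) (j := d - σ - x) (i' := σ + σ + x) (j' := d + σ) (by omega)
        (by omega) (by omega) hkq
      rw [h.eq_neg_one (by omega), hK.1 0 (by omega), show F (σ + σ + x) (d - σ - x) = 1 from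
        hR.1 _ (by omega)] at h1
      have := hF (σ + σ + x) (d + σ)
      omega
    · exact hK.2 _ (by omega) hge
  rcases t with _ | t
  · simp only [Finset.range_zero, Finset.sum_empty]
    omega
  · rw [Finset.sum_range_succ']
    have hrest : ∑ x ∈ Finset.range t, F (σ + σ + (x + 1)) (d + σ) = t := by
      rw [Finset.sum_congr rfl fun x hx => hone (x + 1)
        (by have := Finset.mem_range.mp hx; omega) (Or.inr (by omega))]
      simp
    rw [hrest]
    have h0 := hF (σ + σ + 0) (d + σ)
    refine ⟨by omega, fun hc => ?_⟩
    rw [hone 0 (by omega) (Or.inl (by omega))]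
    omega

/-- Pairing at distance `d + 1` leaves only the rows `d - 1`, `d` and `2 * d` unmatched. -/
theorem sum_far_col_ge (hd : 4 ≤ d) (hZ : CornerFree F (2 * d + 1) (2 * d + 2))
    (h : CornerSplit F d) : -3 ≤ ∑ i ∈ Finset.range (2 * d + 1), F i (2 * d + 1) := by
  obtain ⟨t, ht⟩ : ∃ t, d = t + 1 := ⟨d - 1, by omega⟩
  have hsplit : Finset.range (2 * d + 1) = Finset.range (t + 2 + t + 1) := by
    rw [ht]; congr 1; omega
  rw [hsplit, Finset.sum_range_succ, Finset.sum_range_add, Finset.sum_range_succ,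
    Finset.sum_range_succ]
  have hpair : 0 ≤ ∑ i ∈ Finset.range t, (F i (2 * d + 1) + F (t + 2 + i) (2 * d + 1)) := by
    refine Finset.sum_nonneg fun i hi => ?_
    have := Finset.mem_range.mp hi
    exact pair_nonneg hF hd hZ h (by omega) (by omega) (by omega) (by omega) (by omega) (by omega)
      (by omega) (by omega)
  rw [Finset.sum_add_distrib] at hpair
  have h1 := hF t (2 * d + 1)
  have h2 := hF (t + 1) (2 * d + 1)
  have h3 := hF (t + 2 + t) (2 * d + 1)
  omega

end

theorem CornerSplit.sum_eq {F : ℕ → ℕ → ℤ} {d : ℕ} (h : CornerSplit F d) :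
    ∑ i ∈ Finset.range d, ∑ j ∈ Finset.range d, F i j = -d := by
  have hrow : ∀ i ∈ Finset.range d, ∑ j ∈ Finset.range d, F i j = 2 * (i : ℤ) - d := by
    intro i hi
    have hi := Finset.mem_range.mp hi
    rw [show Finset.range d = Finset.range ((d - i) + i) by congr 1; omega, Finset.sum_range_add,
      Finset.sum_congr rfl fun j hj => h.eq_neg_one
        (by have := Finset.mem_range.mp hj; omega : i + j < d),
      Finset.sum_congr rfl fun j hj => (by
        have := Finset.mem_range.mp hj
        rw [h i hi _ (by omega), if_neg (by omega)] : F i (d - i + j) = 1)]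
    simp
    omega
  rw [Finset.sum_congr rfl hrow, Finset.sum_sub_distrib, ← Finset.mul_sum]
  have := Finset.sum_range_id_mul_two d
  have h2 : (∑ i ∈ Finset.range d, (i : ℤ)) * 2 = d * (d - 1) := by
    rcases d with _ | d
    · simp
    · have : ((∑ i ∈ Finset.range (d + 1), i : ℕ) : ℤ) * 2 = ((d + 1) * d : ℕ) := by
        exact_mod_cast this
      push_cast at this ⊢
      linarith
  simp only [Finset.sum_const, Finset.card_range, nsmul_eq_mul]
  linarith

theorem sum_square_succ (F : ℕ → ℕ → ℤ) (k : ℕ) :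
    ∑ i ∈ Finset.range (k + 1), ∑ j ∈ Finset.range (k + 1), F i j =
      ∑ i ∈ Finset.range k, ∑ j ∈ Finset.range k, F i j + ∑ i ∈ Finset.range k, F i k +
        ∑ j ∈ Finset.range k, F k j + F k k := by
  rw [Finset.sum_range_succ, Finset.sum_range_succ, Finset.sum_congr rfl fun i _ =>
    Finset.sum_range_succ (fun j => F i j) k, Finset.sum_add_distrib]
  ring

/-- The split corner has sum `-d`, and its border of `2 * d + 1` ones raises this to `d + 1`. Each
later border adds two lines bounded by `sum_col_ge` and a diagonal entry. The first two add almost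
`4 * d` of surplus; only the last two, at `k = 2 * d - 1` and `k = 2 * d`, can lose some, at most
`2` each. -/
theorem sum_square_ge {F : ℕ → ℕ → ℤ} (hF : ∀ i j, F i j = 1 ∨ F i j = -1) {d p q : ℕ}
    (hd : 4 ≤ d) (hZ : CornerFree F p q) (h : CornerSplit F d) (τ : ℕ) (hτ : τ ≤ d)
    (hp : d + 1 + τ ≤ p) (hq : d + 1 + τ ≤ q) :
    (d + 1 + τ : ℤ) + (if τ = 0 then 0 else if τ = 1 then 2 * d - 2 else
        if τ + 2 ≤ d then 4 * d - 6 else if τ + 1 ≤ d then 4 * d - 8 else 4 * d - 10) ≤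
      ∑ i ∈ Finset.range (d + 1 + τ), ∑ j ∈ Finset.range (d + 1 + τ), F i j := by
  induction τ with
  | zero =>
    rw [add_zero, sum_square_succ, h.sum_eq,
      Finset.sum_congr rfl fun i hi => h.eq_one hF (by omega) hZ (by omega) (by omega)
        (Finset.mem_range.mp hi).le le_rfl (by omega),
      Finset.sum_congr rfl fun j hj => h.eq_one hF (by omega) hZ (by omega) (by omega)
        le_rfl (Finset.mem_range.mp hj).le (by omega),
      h.eq_one hF (by omega) hZ (by omega) (by omega) le_rfl le_rfl (by omega)]
    simp
  | succ τ ih =>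
    have h1 := ih (by omega) (by omega) (by omega)
    rw [show d + 1 + (τ + 1) = (d + 1 + τ) + 1 by ring, sum_square_succ]
    have hc := sum_col_ge hF hd hZ h (k := d + 1 + τ) (by omega) (by omega) (by omega) (by omega)
      (by omega) (by omega)
    have hr := sum_col_ge (fun i j => hF j i) hd hZ.swap h.swap (k := d + 1 + τ) (by omega)
      (by omega) (by omega) (by omega) (by omega) (by omega)
    have hkk : τ + 1 < d → F (d + 1 + τ) (d + 1 + τ) = 1 := by
      intro hlt
      have hK := colKnown hF hd hZ h (by omega) (by omega) (d + 1 + τ) (by omega) (by omega)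
      have h2 := hZ.ne (i := 0) (j := 0) (i' := d + 1 + τ) (j' := d + 1 + τ) (by omega) (by omega)
        (by omega) (by omega)
      have h3 : F (d + 1 + τ) 0 = 1 := (hK.2 (by omega) (by omega)).1 0 (by omega)
      rw [h.eq_neg_one (by omega), (hK.1 (by omega) (by omega)).1 0 (by omega), h3] at h2
      have := hF (d + 1 + τ) (d + 1 + τ)
      omega
    have hkk' := hF (d + 1 + τ) (d + 1 + τ)
    push_cast at hc hr ⊢
    split_ifs at h1 ⊢ <;> omega

/-- A split corner of at least nearly half the size forces a large sum. -/
theorem corner_bound {F : ℕ → ℕ → ℤ} (hF : ∀ i j, F i j = 1 ∨ F i j = -1) {d p q : ℕ}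
    (hd : 4 ≤ d) (hZ : CornerFree F p q) (h : CornerSplit F d) (hdp : d < p) (hp : p ≤ 2 * d + 1)
    (hpq : p = q ∨ p + 1 = q) :
    (q : ℤ) ≤ ∑ i ∈ Finset.range p, ∑ j ∈ Finset.range q, F i j := by
  obtain ⟨τ, rfl⟩ : ∃ τ, p = d + 1 + τ := ⟨p - (d + 1), by omega⟩
  have h1 := sum_square_ge hF hd hZ h τ (by omega) le_rfl (by omega)
  rcases hpq with rfl | rfl
  · split_ifs at h1 <;> push_cast <;> omega
  · rw [Finset.sum_congr rfl fun i _ => Finset.sum_range_succ (fun j => F i j) (d + 1 + τ),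
      Finset.sum_add_distrib]
    rcases (show τ = d ∨ τ < d by omega) with rfl | hlt
    · have h2 : -3 ≤ ∑ i ∈ Finset.range (τ + 1 + τ), F i (τ + 1 + τ) := by
        have := sum_far_col_ge hF hd (by convert hZ using 1 <;> ring) h
        rwa [show τ + 1 + τ = 2 * τ + 1 by ring]
      split_ifs at h1 <;> push_cast <;> omega
    · have h2 := sum_col_ge hF hd hZ h (k := d + 1 + τ) (by omega) (by omega) (by omega) (by omega)
        (by omega) (by omega)
      push_cast at h2 ⊢
      split_ifs at h1 <;> omega

/-! ### Extending a split window -/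

theorem SplitAt.mono {f : ℤ → ℤ → ℤ} {c a b a' b' : ℤ} {p q p' q' : ℕ}
    (h : SplitAt f c a b p q) (ha : a ≤ a') (hp : a' + p' ≤ a + p) (hb : b ≤ b')
    (hq : b' + q' ≤ b + q) : SplitAt f c a' b' p' q' := fun i j h1 h2 h3 h4 =>
  h i j (by omega) (by omega) (by omega) (by omega)

theorem SplitAt.swap {f : ℤ → ℤ → ℤ} {c a b : ℤ} {p q : ℕ} (h : SplitAt f c a b p q) :
    SplitAt (fun i j => f j i) c b a q p := fun i j h1 h2 h3 h4 => by
  change f j i = _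
  rw [h j i h3 h4 h1 h2, add_comm]

/-- Rotation by a half-turn together with a change of sign. -/
def rotNeg (f : ℤ → ℤ → ℤ) : ℤ → ℤ → ℤ := fun i j => -f (-i) (-j)

theorem IsSign.rotNeg {f : ℤ → ℤ → ℤ} (hf : IsSign f) : IsSign (rotNeg f) := fun i j => by
  unfold _root_.rotNeg
  rcases hf (-i) (-j) with h | h <;> simp [h]

theorem SquareFreeOn.rotNeg {f : ℤ → ℤ → ℤ} {a b : ℤ} {p q : ℕ} (h : SquareFreeOn f a b p q) :
    SquareFreeOn (rotNeg f) (1 - a - p) (1 - b - q) p q := fun i j s hs h1 h2 h3 h4 h5 => by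
  refine h (-(i + s)) (-(j + s)) s hs (by omega) (by omega) (by omega) (by omega) ?_
  rw [show -(i + s) + s = -i by ring, show -(j + s) + s = -j by ring]
  simp only [_root_.rotNeg] at h5
  omega

theorem rectSum_rotNeg (f : ℤ → ℤ → ℤ) (a b : ℤ) (p q : ℕ) :
    rectSum (rotNeg f) (1 - a - p) (1 - b - q) p q = -rectSum f a b p q := by
  have h : rotNeg f = -flipCols (fun i j => flipCols (fun i j => f j i) j i) := by
    funext i j; simp [rotNeg, flipCols]
  rw [h, rectSum_neg, rectSum_flipCols,
    rectSum_swap (flipCols fun i j => f j i) b (1 - a - p) q p, rectSum_flipCols, rectSum_swap]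

theorem MidSplit.rotNeg {f : ℤ → ℤ → ℤ} {a b : ℤ} {p q : ℕ} (h : MidSplit f a b p q) :
    MidSplit (rotNeg f) (1 - a - p) (1 - b - q) p q := by
  obtain ⟨c, hc, h⟩ := h
  refine ⟨-c - 1, by omega, fun i j h1 h2 h3 h4 => ?_⟩
  simp only [_root_.rotNeg, h (-i) (-j) (by omega) (by omega) (by omega) (by omega)]
  split <;> split <;> omega

theorem rotNeg_rotNeg (f : ℤ → ℤ → ℤ) : rotNeg (rotNeg f) = f := by
  funext i j; simp [rotNeg]

section
variable {f : ℤ → ℤ → ℤ} (hf : IsSign f) {a b c : ℤ} {p q d : ℕ}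
include hf

theorem SplitAt.shift_four' {u v : ℤ} (hZ : SquareFreeOn f u (v - 1) 5 5)
    (h : SplitAt f (u + v + 3) u v 4 4) : SplitAt f (u + v + 3) (u + 1) (v - 1) 4 4 := by
  have h1 : SplitAt (fun i j => f j i) (v + u + 3) v u 4 4 := by
    rw [add_comm v u]; exact h.swap
  have h2 := (h1.shift_four (fun i j => hf j i) hZ.swap).swap
  rwa [add_comm v u] at h2

theorem splitAt_four_all (hZ : SquareFreeOn f a b p q) (hc : c + 1 = a + b + d) (hp : d ≤ p)
    (hq : d ≤ q) {u₀ : ℤ} (hu : a ≤ u₀) (hv : u₀ + 4 ≤ a + d)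
    (h : SplitAt f c u₀ (c - 3 - u₀) 4 4) (u : ℤ) (hau : a ≤ u) (hud : u + 4 ≤ a + d) :
    SplitAt f c u (c - 3 - u) 4 4 := by
  have hup : ∀ n : ℕ, a ≤ u₀ - n → SplitAt f c (u₀ - n) (c - 3 - (u₀ - n)) 4 4 := by
    intro n
    induction n with
    | zero => intro _; simpa using h
    | succ n ih =>
      intro hn
      push_cast at hn ⊢
      have h1 := ih (by omega)
      have h2 := SplitAt.shift_four (u := u₀ - n) (v := c - 3 - (u₀ - n)) hf
        (hZ.mono (by omega) (by push_cast; omega) (by omega) (by push_cast; omega))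
        (by convert h1 using 1; ring)
      convert h2 using 1 <;> ring
  have hdown : ∀ n : ℕ, u₀ + n + 4 ≤ a + d → SplitAt f c (u₀ + n) (c - 3 - (u₀ + n)) 4 4 := by
    intro n
    induction n with
    | zero => intro _; simpa using h
    | succ n ih =>
      intro hn
      push_cast at hn ⊢
      have h1 := ih (by omega)
      have h2 := SplitAt.shift_four' (u := u₀ + n) (v := c - 3 - (u₀ + n)) hf
        (hZ.mono (by omega) (by push_cast; omega) (by omega) (by push_cast; omega))
        (by convert h1 using 1; ring)
      convert h2 using 1 <;> ring
  rcases le_total u u₀ with hle | hle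
  · have := hup (u₀ - u).toNat (by omega)
    rwa [show u₀ - ((u₀ - u).toNat : ℤ) = u by omega] at this
  · have := hdown (u - u₀).toNat (by omega)
    rwa [show u₀ + ((u - u₀).toNat : ℤ) = u by omega] at this

/-- The small window slides along the whole antidiagonal of the corner. Two consecutive split `k ×
k` windows on it cover a `(k + 1) × (k + 1)` window except for its upper left and lower right cells,
and squares of side `k - 1` force these two. -/
theorem splitAt_corner (hZ : SquareFreeOn f a b p q) (hc : c + 1 = a + b + d) (hd : 4 ≤ d)
    (hp : d ≤ p) (hq : d ≤ q) {u₀ : ℤ} (hu : a ≤ u₀) (hv : u₀ + 4 ≤ a + d)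
    (h : SplitAt f c u₀ (c - 3 - u₀) 4 4) : SplitAt f c a b d d := by
  have key : ∀ k : ℕ, 4 ≤ k → k ≤ d → ∀ u : ℤ, a ≤ u → u + k ≤ a + d →
      SplitAt f c u (c + 1 - k - u) k k := by
    intro k hk
    induction k, hk using Nat.le_induction with
    | base =>
      intro _ u h1 h2
      have := splitAt_four_all hf hZ hc hp hq hu hv h u h1 h2
      convert this using 1
      push_cast; ring
    | succ k hk ih =>
      intro hkd u hau hud
      push_cast at hud ⊢
      have h1 := ih (by omega) u hau (by omega)
      have h2 := ih (by omega) (u + 1) (by omega) (by omega)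
      obtain ⟨v, hv⟩ : ∃ v, v = c + 1 - (k + 1) - u := ⟨_, rfl⟩
      rw [← hv]
      have hin : ∀ i j, u ≤ i → i ≤ u + k → v ≤ j → j ≤ v + k → (i < u + k ∧ v < j ∨
          u < i ∧ j < v + k) → f i j = if i + j ≤ c then -1 else 1 := by
        rintro i j hi1 hi2 hj1 hj2 (⟨h3, h4⟩ | ⟨h3, h4⟩)
        exacts [h1 i j (by omega) (by omega) (by omega) (by omega),
          h2 i j (by omega) (by omega) (by omega) (by omega)]
      intro i j hi1 hi2 hj1 hj2
      push_cast at hi2 hj2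
      by_cases hcase : i < u + k ∧ v < j ∨ u < i ∧ j < v + k
      · exact hin i j hi1 (by omega) hj1 (by omega) hcase
      · rcases (by omega : i = u ∧ j = v ∨ i = u + k ∧ j = v + k) with ⟨rfl, rfl⟩ | ⟨rfl, rfl⟩
        · have h3 := hZ i j (k - 1) (by omega) (by omega) (by omega) (by omega) (by omega)
          rw [hin i (j + (k - 1)) (by omega) (by omega) (by omega) (by omega) (by omega),
            hin (i + (k - 1)) j (by omega) (by omega) (by omega) (by omega) (by omega),
            hin (i + (k - 1)) (j + (k - 1)) (by omega) (by omega) (by omega) (by omega) (by omega),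
            if_pos (by omega), if_pos (by omega), if_neg (by omega)] at h3
          rw [if_pos (by omega)]
          have := hf i j
          omega
        · have h3 := hZ (u + 1) (v + 1) (k - 1) (by omega) (by omega) (by omega) (by omega)
            (by omega)
          rw [show u + 1 + ((k : ℤ) - 1) = u + k by ring,
            show v + 1 + ((k : ℤ) - 1) = v + k by ring,
            hin (u + 1) (v + 1) (by omega) (by omega) (by omega) (by omega) (by omega),
            hin (u + 1) (v + k) (by omega) (by omega) (by omega) (by omega) (by omega),
            hin (u + k) (v + 1) (by omega) (by omega) (by omega) (by omega) (by omega),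
            if_pos (by omega), if_neg (by omega), if_neg (by omega)] at h3
          rw [if_neg (by omega)]
          have := hf (u + k) (v + k)
          omega
  have := key d hd le_rfl a le_rfl le_rfl
  rwa [show c + 1 - d - a = b by omega] at this

/-- `hd2` says that the cut does not lie beyond the centre. Either the corner fits strictly inside,
and `corner_bound` applies, or it is the full height and one further column of ones completes the
split. -/
theorem midSplit_or_le_of_four (hZ : SquareFreeOn f a b p q) (hc : c + 1 = a + b + d)
    (hd : 4 ≤ d) (hpq : p = q ∨ p + 1 = q) (hd2 : 2 * d + 1 ≤ p + q) (hp : p ≤ 2 * d + 1)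
    {u₀ : ℤ} (hu : a ≤ u₀) (hv : u₀ + 4 ≤ a + d)
    (h : SplitAt f c u₀ (c - 3 - u₀) 4 4) : MidSplit f a b p q ∨ q ≤ rectSum f a b p q := by
  have hcs := splitAt_corner hf hZ hc hd (by omega) (by omega) hu hv h
  have hF : ∀ i j : ℕ, f (a + i) (b + j) = 1 ∨ f (a + i) (b + j) = -1 := fun i j => hf _ _
  have hZ' : CornerFree (fun i j : ℕ => f (a + i) (b + j)) p q := by
    intro i j s hs hi hj h0
    refine hZ (a + i) (b + j) s (by omega) (by omega) (by omega) (by omega) (by omega) ?_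
    push_cast at h0
    simpa only [add_assoc] using h0
  have hC : CornerSplit (fun i j : ℕ => f (a + i) (b + j)) d := by
    intro i hi j hj
    dsimp only
    rw [hcs (a + i) (b + j) (by omega) (by omega) (by omega) (by omega)]
    split <;> split <;> omega
  rcases (by omega : d < p ∨ d = p ∧ p + 1 = q) with hdp | ⟨rfl, rfl⟩
  · exact Or.inr (corner_bound hF hd hZ' hC hdp hp hpq)
  · refine Or.inl ⟨c, by omega, fun i j h1 h2 h3 h4 => ?_⟩
    rcases (by omega : j < b + d ∨ j = b + d) with hj | rfl
    · exact hcs i j h1 h2 h3 hj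
    · have := hC.next_col hF (by omega) hZ' le_rfl (by omega) (i - a).toNat (by omega)
      rw [show a + ((i - a).toNat : ℤ) = i by omega] at this
      rw [this, if_neg (by omega)]

end

theorem MidSplit.extend_of_le {f : ℤ → ℤ → ℤ} (hf : IsSign f) {a b u v : ℤ} {p q p' q' m : ℕ}
    (hZ : SquareFreeOn f a b p q) (hm : 4 ≤ m) (hw : p' = m ∧ q' = m + 1 ∨ p' = m + 1 ∧ q' = m)
    (hu : a ≤ u) (hu' : u + p' ≤ a + p) (hv : b ≤ v) (hv' : v + q' ≤ b + q)
    (h : MidSplit f u v p' q') (hpq : p = q ∨ p + 1 = q) (hle : p + q ≤ 4 * m + 3) :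
    MidSplit f a b p q ∨ q ≤ |rectSum f a b p q| := by
  have main : ∀ {f : ℤ → ℤ → ℤ} {a b u v : ℤ}, IsSign f → SquareFreeOn f a b p q → a ≤ u →
      b ≤ v → ∀ c, 2 * (c - u - v) + 3 = p' + q' → SplitAt f c u v p' q' →
      2 * (c - a - b) + 3 ≤ p + q → MidSplit f a b p q ∨ q ≤ rectSum f a b p q := by
    intro f a b u v hf hZ hu hv c hc hs hcpq
    -- Here `d` is the size of the corner of the rectangle ending at the cut; it is at least `m`,
    -- whence `p ≤ 2 * d + 1`.
    refine midSplit_or_le_of_four hf hZ (c := c) (d := (c + 1 - a - b).toNat) (u₀ := u) (by omega)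
      (by omega) hpq (by omega) (by omega) hu (by omega) ?_
    exact hs.mono le_rfl (by push_cast; omega) (by omega) (by push_cast; omega)
  obtain ⟨c, hc, hs⟩ := h
  rcases le_total (2 * (c - a - b) + 3) (p + q) with hcpq | hcpq
  · exact (main hf hZ hu hv c hc hs hcpq).imp_right fun h => h.trans (le_abs_self _)
  -- A half-turn with change of sign preserves the shape of the split and brings a cut beyond the
  -- centre to the near side.
  · obtain ⟨c', hc', hs'⟩ := MidSplit.rotNeg (f := f) (a := u) (b := v) (p := p') (q := q') ⟨c, hc, hs⟩
    have := main hf.rotNeg hZ.rotNeg (u := 1 - u - p') (v := 1 - v - q') (by omega) (by omega)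
      c' hc' hs' (by omega)
    rcases this with h | h
    · left
      have h2 := h.rotNeg
      rwa [rotNeg_rotNeg, show 1 - (1 - a - (p : ℤ)) - p = a by ring,
        show 1 - (1 - b - (q : ℤ)) - q = b by ring] at h2
    · right
      rw [rectSum_rotNeg] at h
      exact h.trans (neg_le_abs _)

/-- If a rectangle of at most about twice the size contains a window split through its centre,
then the rectangle itself is split through its centre, or its sum is large. -/
theorem MidSplit.extend {f : ℤ → ℤ → ℤ} (hf : IsSign f) {a b u v : ℤ} {p q p' q' m : ℕ}
    (hZ : SquareFreeOn f a b p q) (hm : 4 ≤ m) (hw : p' = m ∧ q' = m + 1 ∨ p' = m + 1 ∧ q' = m)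
    (hu : a ≤ u) (hu' : u + p' ≤ a + p) (hv : b ≤ v) (hv' : v + q' ≤ b + q)
    (h : MidSplit f u v p' q') (hpq : p ≤ q + 1) (hqp : q ≤ p + 1) (hle : p + q ≤ 4 * m + 3) :
    MidSplit f a b p q ∨ (max p q : ℕ) ≤ |rectSum f a b p q| := by
  rcases le_total p q with hl | hl
  · rw [max_eq_right hl]
    exact h.extend_of_le hf hZ hm hw hu hu' hv hv' (by omega) hle
  · rw [max_eq_left hl]
    have := h.swap.extend_of_le (fun i j => hf j i) hZ.swap hm (by omega) hv hv' hu hu' (by omega)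
      (by omega)
    rw [rectSum_swap] at this
    exact this.imp_left fun h => h.swap

theorem AnyMidSplit.extend {f : ℤ → ℤ → ℤ} (hf : IsSign f) {a b u v : ℤ} {p q p' q' m : ℕ}
    (hZ : SquareFreeOn f a b p q) (hm : 4 ≤ m) (hw : p' = m ∧ q' = m + 1 ∨ p' = m + 1 ∧ q' = m)
    (hu : a ≤ u) (hu' : u + p' ≤ a + p) (hv : b ≤ v) (hv' : v + q' ≤ b + q)
    (h : AnyMidSplit f u v p' q') (hpq : p ≤ q + 1) (hqp : q ≤ p + 1) (hle : p + q ≤ 4 * m + 3) :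
    AnyMidSplit f a b p q ∨ (max p q : ℕ) ≤ |rectSum f a b p q| := by
  rcases h with (h | h) | (h | h)
  · exact (h.extend hf hZ hm hw hu hu' hv hv' hpq hqp hle).imp_left fun h => Or.inl (Or.inl h)
  · have := h.extend hf.neg hZ.neg hm hw hu hu' hv hv' hpq hqp hle
    rw [rectSum_neg, abs_neg] at this
    exact this.imp_left fun h => Or.inl (Or.inr h)
  · have := h.extend hf.flipCols hZ.flipCols hm hw hu hu' (by omega) (by omega) hpq hqp hle
    rw [rectSum_flipCols] at this
    exact this.imp_left fun h => Or.inr (Or.inl h)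
  · have := h.extend hf.flipCols.neg hZ.flipCols.neg hm hw hu hu' (by omega) (by omega) hpq hqp hle
    rw [rectSum_neg, abs_neg, rectSum_flipCols] at this
    exact this.imp_left fun h => Or.inr (Or.inr h)

/-! ### Windows whose sums have a common sign -/

theorem rectSum_rows (f : ℤ → ℤ → ℤ) {a a' b : ℤ} {p p₁ p₂ q : ℕ} (hp : p = p₁ + p₂)
    (ha : a' = a + p₁) : rectSum f a b p q = rectSum f a b p₁ q + rectSum f a' b p₂ q := by
  subst hp ha
  unfold rectSum
  rw [Finset.sum_range_add]
  simp only [Nat.cast_add, add_assoc]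

theorem rectSum_cols (f : ℤ → ℤ → ℤ) {a b b' : ℤ} {p q q₁ q₂ : ℕ} (hq : q = q₁ + q₂)
    (hb : b' = b + q₁) : rectSum f a b p q = rectSum f a b p q₁ + rectSum f a b' p q₂ := by
  simp only [← rectSum_swap f]
  exact rectSum_rows _ hq hb

theorem abs_rectSum_le {f : ℤ → ℤ → ℤ} (hf : IsSign f) (a b : ℤ) (p q : ℕ) :
    |rectSum f a b p q| ≤ (p * q : ℕ) := by
  have h1 : ∀ i j, |f i j| = 1 := fun i j => by rcases hf i j with h | h <;> simp [h]
  calc |rectSum f a b p q|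
      ≤ ∑ i ∈ Finset.range p, ∑ j ∈ Finset.range q, |f (a + i) (b + j)| :=
        (Finset.abs_sum_le_sum_abs _ _).trans
          (Finset.sum_le_sum fun i _ => Finset.abs_sum_le_sum_abs _ _)
    _ = (p * q : ℕ) := by simp [h1]

/-- A `p × q` window inside the `P × Q` rectangle at `(a, b)`. -/
structure Inside (a b : ℤ) (P Q : ℕ) (u v : ℤ) (p q : ℕ) : Prop where
  top : a ≤ u
  bottom : u + p ≤ a + P
  left : b ≤ v
  right : v + q ≤ b + Q

/-- In the rectangle, the sum over any window with sides `m` or `m + 1` is at least the longer side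
of the window in absolute value. -/
def LargeWindows (m : ℕ) (f : ℤ → ℤ → ℤ) (a b : ℤ) (P Q : ℕ) : Prop :=
  ∀ (u v : ℤ) (p q : ℕ), (p = m ∨ p = m + 1) → (q = m ∨ q = m + 1) → Inside a b P Q u v p q →
    (max p q : ℕ) ≤ |rectSum f u v p q|

theorem LargeWindows.swap {m : ℕ} {f : ℤ → ℤ → ℤ} {a b : ℤ} {P Q : ℕ}
    (h : LargeWindows m f a b P Q) : LargeWindows m (fun i j => f j i) b a Q P :=
  fun u v p q hp hq hi => by
    rw [rectSum_swap, max_comm]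
    exact h v u q p hq hp ⟨hi.left, hi.right, hi.top, hi.bottom⟩

section
variable {m : ℕ} {f : ℤ → ℤ → ℤ} {a b : ℤ} {P Q : ℕ}

/-- Dropping a column of height `p` changes the sum by at most `p`, but a change of sign would need
at least `p + m + 1`. -/
theorem LargeWindows.pos_add_col (hf : IsSign f) (h : LargeWindows m f a b P Q) (hm : 0 < m)
    {u v : ℤ} {p : ℕ} (hp : p = m ∨ p = m + 1) (hi : Inside a b P Q u v p (m + 1)) :
    (0 < rectSum f u v p (m + 1) ↔ 0 < rectSum f u v p m) ∧
      (0 < rectSum f u v p (m + 1) ↔ 0 < rectSum f u (v + 1) p m) := by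
  obtain ⟨h1, h2, h3, h4⟩ := hi
  have e0 := h u v p (m + 1) hp (Or.inr rfl) ⟨h1, h2, h3, h4⟩
  have e1 := h u v p m hp (Or.inl rfl) ⟨h1, h2, h3, by omega⟩
  have e2 := h u (v + 1) p m hp (Or.inl rfl) ⟨h1, h2, by omega, by omega⟩
  have s1 := rectSum_cols f (a := u) (b := v) (p := p) (q := m + 1) (q₁ := m) (q₂ := 1) rfl rfl
  have s2 := rectSum_cols f (a := u) (b := v) (b' := v + 1) (p := p) (q := m + 1) (q₁ := 1)
    (q₂ := m) (add_comm _ _) (by simp)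
  have l1 := abs_rectSum_le hf u (v + m) p 1
  have l2 := abs_rectSum_le hf u v p 1
  rw [mul_one, abs_le] at l1 l2
  rw [le_abs] at e0 e1 e2
  constructor <;> omega

theorem LargeWindows.pos_add_row (hf : IsSign f) (h : LargeWindows m f a b P Q) (hm : 0 < m)
    {u v : ℤ} {q : ℕ} (hq : q = m ∨ q = m + 1) (hi : Inside a b P Q u v (m + 1) q) :
    (0 < rectSum f u v (m + 1) q ↔ 0 < rectSum f u v m q) ∧
      (0 < rectSum f u v (m + 1) q ↔ 0 < rectSum f (u + 1) v m q) := by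
  have := h.swap.pos_add_col (fun i j => hf j i) hm hq
    ⟨hi.left, hi.right, hi.top, hi.bottom⟩
  simpa only [rectSum_swap] using this

theorem LargeWindows.pos_square (hf : IsSign f) (h : LargeWindows m f a b P Q) (hm : 0 < m)
    (k l : ℕ) (hk : k + m ≤ P) (hl : l + m ≤ Q) :
    0 < rectSum f (a + k) (b + l) m m ↔ 0 < rectSum f a b m m := by
  have hcol : ∀ l : ℕ, l + m ≤ Q →
      (0 < rectSum f (a + k) (b + l) m m ↔ 0 < rectSum f (a + k) b m m) := by
    intro l
    induction l with
    | zero => simp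
    | succ l ih =>
      intro hl
      have := h.pos_add_col hf hm (u := a + k) (v := b + l) (Or.inl rfl)
        ⟨by omega, by omega, by omega, by omega⟩
      rw [← ih (by omega), ← this.1, this.2, Nat.cast_succ, add_assoc]
  rw [hcol l hl]
  clear hcol
  induction k with
  | zero => simp
  | succ k ih =>
    have := h.pos_add_row hf hm (u := a + k) (v := b) (Or.inl rfl)
      ⟨by omega, by omega, by omega, by omega⟩
    exact (by simpa only [Nat.cast_succ, add_assoc] using this.2.symm.trans this.1 : _ ↔ _).trans (ih (by omega))

theorem LargeWindows.pos_iff (hf : IsSign f) (h : LargeWindows m f a b P Q) (hm : 0 < m)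
    {u v : ℤ} {p q : ℕ} (hp : p = m ∨ p = m + 1) (hq : q = m ∨ q = m + 1)
    (hi : Inside a b P Q u v p q) : 0 < rectSum f u v p q ↔ 0 < rectSum f a b m m := by
  obtain ⟨h1, h2, h3, h4⟩ := hi
  have hmm := h.pos_square hf hm (u - a).toNat (v - b).toNat (by omega) (by omega)
  rw [Int.toNat_of_nonneg (by omega), Int.toNat_of_nonneg (by omega), add_sub_cancel,
    add_sub_cancel] at hmm
  rw [← hmm]
  have hq' : 0 < rectSum f u v p q ↔ 0 < rectSum f u v p m := by
    rcases hq with rfl | rfl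
    exacts [Iff.rfl, (h.pos_add_col hf hm hp ⟨h1, h2, h3, h4⟩).1]
  rw [hq']
  rcases hp with rfl | rfl
  exacts [Iff.rfl, (h.pos_add_row hf hm (Or.inl rfl) ⟨h1, h2, h3, by omega⟩).1]

theorem LargeWindows.four_mul_le (hf : IsSign f) (h : LargeWindows m f a b P Q) (hm : 0 < m)
    (hP : 2 * m ≤ P) (hP' : P ≤ 2 * m + 2) (hQ : 2 * m ≤ Q) (hQ' : Q ≤ 2 * m + 2) :
    4 * (m : ℤ) ≤ |rectSum f a b P Q| := by
  obtain ⟨p₁, p₂, hp₁, hp₂, rfl⟩ :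
      ∃ p₁ p₂, (p₁ = m ∨ p₁ = m + 1) ∧ (p₂ = m ∨ p₂ = m + 1) ∧ P = p₁ + p₂ := by
    rcases (by omega : P = m + m ∨ P = m + (m + 1) ∨ P = m + 1 + (m + 1)) with h | h | h
    exacts [⟨_, _, by simp, by simp, h⟩, ⟨_, _, by simp, by simp, h⟩, ⟨_, _, by simp, by simp, h⟩]
  obtain ⟨q₁, q₂, hq₁, hq₂, rfl⟩ :
      ∃ p₁ p₂, (p₁ = m ∨ p₁ = m + 1) ∧ (p₂ = m ∨ p₂ = m + 1) ∧ Q = p₁ + p₂ := by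
    rcases (by omega : Q = m + m ∨ Q = m + (m + 1) ∨ Q = m + 1 + (m + 1)) with h | h | h
    exacts [⟨_, _, by simp, by simp, h⟩, ⟨_, _, by simp, by simp, h⟩, ⟨_, _, by simp, by simp, h⟩]
  rw [rectSum_rows f (p₁ := p₁) (p₂ := p₂) rfl rfl, rectSum_cols f (q₁ := q₁) (q₂ := q₂) rfl rfl,
    rectSum_cols f (a := a + p₁) (q₁ := q₁) (q₂ := q₂) rfl rfl]
  have key : ∀ (u v : ℤ) (p q : ℕ), (p = m ∨ p = m + 1) → (q = m ∨ q = m + 1) →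
      Inside a b (p₁ + p₂) (q₁ + q₂) u v p q → m ≤ |rectSum f u v p q| ∧
      (0 < rectSum f u v p q ↔ 0 < rectSum f a b m m) := fun u v p q hp hq hi =>
    ⟨by have := h u v p q hp hq hi; omega, h.pos_iff hf hm hp hq hi⟩
  have k1 := key a b p₁ q₁ hp₁ hq₁ ⟨by omega, by omega, by omega, by omega⟩
  have k2 := key a (b + q₁) p₁ q₂ hp₁ hq₂ ⟨by omega, by omega, by omega, by omega⟩
  have k3 := key (a + p₁) b p₂ q₁ hp₂ hq₁ ⟨by omega, by omega, by omega, by omega⟩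
  have k4 := key (a + p₁) (b + q₁) p₂ q₂ hp₂ hq₂ ⟨by omega, by omega, by omega, by omega⟩
  rw [le_abs] at k1 k2 k3 k4 ⊢
  omega

end

/-! ### Rectangles with a small sum -/

/-- A nearly square rectangle with a small sum and without zero-sum squares is split through its
centre. -/
def SmallSumSplit (p q : ℕ) : Prop :=
  ∀ f : ℤ → ℤ → ℤ, IsSign f → ∀ a b : ℤ, SquareFreeOn f a b p q →
    |rectSum f a b p q| < (max p q : ℕ) → AnyMidSplit f a b p q

theorem SmallSumSplit.swap {p q : ℕ} (h : SmallSumSplit p q) : SmallSumSplit q p :=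
  fun f hf a b hZ hs => by
    have := h (fun i j => f j i) (fun i j => hf j i) b a hZ.swap
      (by rwa [rectSum_swap, max_comm])
    exact this.swap

/-- From windows of sides `m` and `m + 1` to rectangles of about twice the size. -/
theorem anyMidSplit_of_windows {f : ℤ → ℤ → ℤ} (hf : IsSign f) {a b : ℤ} {p q m : ℕ}
    (hZ : SquareFreeOn f a b p q) (hm : 4 ≤ m)
    (H : ∀ (u v : ℤ) (p' q' : ℕ), (p' = m ∨ p' = m + 1) → (q' = m ∨ q' = m + 1) →
      Inside a b p q u v p' q' → |rectSum f u v p' q'| < (max p' q' : ℕ) →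
      AnyMidSplit f u v p' q')
    (hp : 2 * m ≤ p) (hp' : p ≤ 2 * m + 2) (hq : 2 * m ≤ q) (hq' : q ≤ 2 * m + 2)
    (hpq : p ≤ q + 1) (hqp : q ≤ p + 1) (hle : p + q ≤ 4 * m + 3)
    (hs : |rectSum f a b p q| < (max p q : ℕ)) : AnyMidSplit f a b p q := by
  by_cases hL : LargeWindows m f a b p q
  · have := hL.four_mul_le hf (by omega) hp hp' hq hq'
    omega
  · simp only [LargeWindows, not_forall, not_le] at hL
    obtain ⟨u, v, p', q', h1, h2, hi, h3⟩ := hL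
    have h := H u v p' q' h1 h2 hi h3
    -- Square windows cannot be split through the centre, so the window found is `m × (m + 1)` or
    -- its transpose.
    have hne : p' ≠ q' := by
      rintro rfl
      exact not_anyMidSplit_square _ _ _ _ h
    exact (h.extend hf hZ hm (by omega) hi.top hi.bottom hi.left hi.right hpq hqp
      hle).resolve_right hs.not_ge

theorem SmallSumSplit.double {m p q : ℕ} (hm : 5 ≤ m) (h : SmallSumSplit m m)
    (h' : SmallSumSplit m (m + 1)) (h'' : SmallSumSplit (m + 1) (m + 1))
    (hp : 2 * m ≤ p) (hp' : p ≤ 2 * m + 2) (hq : 2 * m ≤ q) (hq' : q ≤ 2 * m + 2)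
    (hpq : p ≤ q + 1) (hqp : q ≤ p + 1) (hle : p + q ≤ 4 * m + 3) : SmallSumSplit p q :=
  fun f hf a b hZ hs => by
    refine anyMidSplit_of_windows hf hZ (by omega) ?_ hp hp' hq hq' hpq hqp hle hs
    intro u v p' q' h1 h2 hi
    have hZ' := hZ.mono hi.top hi.bottom hi.left hi.right
    rcases h1 with rfl | rfl <;> rcases h2 with rfl | rfl
    exacts [h f hf u v hZ', h' f hf u v hZ', h'.swap f hf u v hZ', h'' f hf u v hZ']

/-- Size `4` is not covered by the induction; here its windows lie in `5 × 5` squares of the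
rectangle, where the search applies. -/
theorem SmallSumSplit.double_four {p q : ℕ} (hp : 8 ≤ p) (hp' : p ≤ 10) (hq : 8 ≤ q)
    (hq' : q ≤ 10) (hpq : p ≤ q + 1) (hqp : q ≤ p + 1) (hle : p + q ≤ 19) : SmallSumSplit p q :=
  fun f hf a b hZ hs => by
    refine anyMidSplit_of_windows hf hZ le_rfl ?_ hp hp' hq hq' hpq hqp hle hs
    intro u v p' q' h1 h2 ⟨i1, i2, i3, i4⟩ hs'
    rcases h1 with rfl | rfl <;> rcases h2 with rfl | rfl
    · exact absurd hs' (not_lt.mpr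
        (four_le_abs_rectSum_four hf hZ (by omega) (by omega) i1 i2 i3 i4))
    · exact anyMidSplit_four_five hf hZ (by omega) i1 i2 i3 i4 hs'
    · exact anyMidSplit_five_four hf hZ (by omega) i1 i2 i3 i4 hs'
    · exact absurd hs' (not_lt.mpr (five_le_abs_rectSum_five hf (hZ.mono i1 i2 i3 i4)))

theorem HasMidSplit.extend {f : ℤ → ℤ → ℤ} (hf : IsSign f) {a b u v : ℤ} {p q p' q' : ℕ}
    (hZ : SquareFreeOn f a b p q) (hi : Inside a b p q u v p' q') (h : HasMidSplit f u v p' q')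
    (hpq : p ≤ q + 1) (hqp : q ≤ p + 1) (hle : p + q ≤ 19)
    (hs : |rectSum f a b p q| < (max p q : ℕ)) : AnyMidSplit f a b p q := by
  obtain ⟨u', v', p₁, q₁, hw, h1, h2, h3, h4, h⟩ := h
  obtain ⟨i1, i2, i3, i4⟩ := hi
  exact (h.extend hf hZ le_rfl hw (by omega) (by omega) (by omega) (by omega) hpq hqp
    hle).resolve_right hs.not_ge

theorem smallSumSplit_five : SmallSumSplit 5 5 := fun _ hf _ _ hZ hs =>
  absurd hs (not_lt.mpr (five_le_abs_rectSum_five hf hZ))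

theorem smallSumSplit_five_six : SmallSumSplit 5 6 := fun _ hf _ _ hZ hs =>
  (hasMidSplit_five_six hf hZ hs).extend hf hZ ⟨le_rfl, le_rfl, le_rfl, le_rfl⟩ (by omega)
    (by omega) (by omega) hs

/-- Rectangles containing a `6 × 6` square reduce to the case in which all of these squares have
a large sum. -/
theorem smallSumSplit_of_six {p q : ℕ} (hpq : p ≤ q + 1) (hqp : q ≤ p + 1) (hle : p + q ≤ 19)
    (H : ∀ (f : ℤ → ℤ → ℤ) (a b : ℤ), IsSign f →
      (∀ u v : ℤ, Inside a b p q u v 6 6 → 18 ≤ |rectSum f u v 6 6|) →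
      (max p q : ℕ) ≤ |rectSum f a b p q|) : SmallSumSplit p q := fun f hf a b hZ hs => by
  by_cases h : ∀ u v : ℤ, Inside a b p q u v 6 6 → 18 ≤ |rectSum f u v 6 6|
  · exact absurd hs (not_lt.mpr (H f a b hf h))
  · simp only [not_forall, not_le] at h
    obtain ⟨u, v, hi, h⟩ := h
    exact (hasMidSplit_six_six hf (hZ.mono hi.top hi.bottom hi.left hi.right) h).extend hf hZ hi
      hpq hqp hle hs

theorem smallSumSplit_six : SmallSumSplit 6 6 :=
  smallSumSplit_of_six (by omega) (by omega) (by omega) fun f a b _ h => by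
    have := h a b ⟨le_rfl, le_rfl, le_rfl, le_rfl⟩
    omega

theorem smallSumSplit_six_seven : SmallSumSplit 6 7 :=
  smallSumSplit_of_six (by omega) (by omega) (by omega) fun f a b hf h => by
    have h1 := h a b ⟨le_rfl, le_rfl, le_rfl, by omega⟩
    have h2 := rectSum_cols f (a := a) (b := b) (p := 6) (q := 7) (q₁ := 6) (q₂ := 1) rfl rfl
    have h3 := abs_rectSum_le hf a (b + (6 : ℕ)) 6 1
    rw [le_abs] at h1 ⊢
    rw [abs_le] at h3
    omega

/-- If all `6 × 6` windows have a large sum, so has a slightly larger rectangle. -/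
theorem nine_le_abs_rectSum {f : ℤ → ℤ → ℤ} (hf : IsSign f) {a b : ℤ} {q x y : ℕ}
    (hxy : x + y = 6) (hx : 1 ≤ x) (hx' : x ≤ 2) (hq : q = y + 2 * x)
    (h : ∀ u v : ℤ, Inside a b 7 q u v 6 6 → 18 ≤ |rectSum f u v 6 6|) :
    9 ≤ |rectSum f a b 7 q| := by
  have rows := fun v r => rectSum_rows f (a := a) (a' := a + 1) (b := v) (p := 7) (p₁ := 1)
    (p₂ := 6) (q := r) rfl rfl
  have top := fun v r => rectSum_rows f (a := a) (a' := a + 1) (b := v) (p := 6) (p₁ := 1)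
    (p₂ := 5) (q := r) rfl rfl
  have bot := fun v r => rectSum_rows f (a := a + 1) (a' := a + 6) (b := v) (p := 6) (p₁ := 5)
    (p₂ := 1) (q := r) rfl (by push_cast; ring)
  have cols := fun u p => rectSum_cols f (a := u) (b := b) (b' := b + x) (p := p) (q := q)
    (q₁ := x) (q₂ := 6) (by omega) rfl
  have left := fun u p => rectSum_cols f (a := u) (b := b) (b' := b + x) (p := p) (q := 6)
    (q₁ := x) (q₂ := y) (by omega) rfl
  have right := fun u p => rectSum_cols f (a := u) (b := b + x) (b' := b + 6) (p := p) (q := 6)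
    (q₁ := y) (q₂ := x) (by omega) (by omega)
  have s1 := h a b ⟨by omega, by omega, by omega, by omega⟩
  have s2 := h a (b + x) ⟨by omega, by omega, by omega, by omega⟩
  have s3 := h (a + 1) b ⟨by omega, by omega, by omega, by omega⟩
  have s4 := h (a + 1) (b + x) ⟨by omega, by omega, by omega, by omega⟩
  have bd := fun u v p q => abs_le.mp (abs_rectSum_le hf u v p q)
  have b1 := bd a b 1 x
  have b2 := bd a (b + x) 1 y
  have b3 := bd a (b + 6) 1 x
  have b4 := bd (a + 1) b 5 x
  have b5 := bd (a + 1) (b + x) 5 y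
  have b6 := bd (a + 1) (b + 6) 5 x
  have b7 := bd (a + 6) b 1 x
  have b8 := bd (a + 6) (b + x) 1 y
  have b9 := bd (a + 6) (b + 6) 1 x
  rw [top, left, left] at s1
  rw [top, right, right] at s2
  rw [bot, left, left] at s3
  rw [bot, right, right] at s4
  rw [rows, bot, cols, cols, cols, right, right, right]
  clear rows top bot cols left right bd h
  generalize rectSum f a b 1 x = c1 at *
  generalize rectSum f a (b + x) 1 y = c2 at *
  generalize rectSum f a (b + 6) 1 x = c3 at *
  generalize rectSum f (a + 1) b 5 x = c4 at *
  generalize rectSum f (a + 1) (b + x) 5 y = c5 at *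
  generalize rectSum f (a + 1) (b + 6) 5 x = c6 at *
  generalize rectSum f (a + 6) b 1 x = c7 at *
  generalize rectSum f (a + 6) (b + x) 1 y = c8 at *
  generalize rectSum f (a + 6) (b + 6) 1 x = c9 at *
  push_cast at *
  have hy : (y : ℤ) = 6 - x := by omega
  have hx : (1 : ℤ) ≤ x := by omega
  have hx' : (x : ℤ) ≤ 2 := by omega
  rw [le_abs] at *
  -- Any two of the four windows share at least `5 * y ≥ 20` cells, so their sums differ by at most
  -- `32 < 36` and have a common sign. Two opposite windows total at least `36`, count the `5 × y`
  -- centre twice and miss two `1 × x` blocks, so the whole is at least `36 - 5 * y - 2 * x = 6 + 3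
  -- * x ≥ 9` in absolute value.
  rcases s1 with s1 | s1
  · have t2 := s2.resolve_right (by linarith)
    have t3 := s3.resolve_right (by linarith)
    have t4 := s4.resolve_right (by linarith)
    left
    linarith
  · have t2 := s2.resolve_left (by linarith)
    have t3 := s3.resolve_left (by linarith)
    have t4 := s4.resolve_left (by linarith)
    right
    linarith

theorem smallSumSplit_seven : SmallSumSplit 7 7 :=
  smallSumSplit_of_six (by omega) (by omega) (by omega) fun f a b hf h => by
    have := nine_le_abs_rectSum hf (q := 7) (x := 1) (y := 5) rfl (by omega) (by omega) rfl h
    omega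

theorem smallSumSplit_seven_eight : SmallSumSplit 7 8 :=
  smallSumSplit_of_six (by omega) (by omega) (by omega) fun f a b hf h => by
    have := nine_le_abs_rectSum hf (q := 8) (x := 2) (y := 4) rfl (by omega) (by omega) rfl h
    omega

theorem smallSumSplit_all (n : ℕ) (hn : 5 ≤ n) : SmallSumSplit n n ∧ SmallSumSplit n (n + 1) := by
  induction n using Nat.strong_induction_on with
  | _ n ih =>
    rcases (by omega : n = 5 ∨ n = 6 ∨ n = 7 ∨ n = 8 ∨ n = 9 ∨ 10 ≤ n) with
      rfl | rfl | rfl | rfl | rfl | hn'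
    · exact ⟨smallSumSplit_five, smallSumSplit_five_six⟩
    · exact ⟨smallSumSplit_six, smallSumSplit_six_seven⟩
    · exact ⟨smallSumSplit_seven, smallSumSplit_seven_eight⟩
    · constructor <;> exact SmallSumSplit.double_four (by omega) (by omega) (by omega) (by omega)
        (by omega) (by omega) (by omega)
    · constructor <;> exact SmallSumSplit.double_four (by omega) (by omega) (by omega) (by omega)
        (by omega) (by omega) (by omega)
    · have h1 := ih (n / 2) (by omega) (by omega)
      have h2 := (ih (n / 2 + 1) (by omega) (by omega)).1
      constructor <;> exact SmallSumSplit.double (m := n / 2) (by omega) h1.1 h1.2 h2 (by omega)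
        (by omega) (by omega) (by omega) (by omega) (by omega) (by omega)

/-! ### Discrepancies of matrices -/

/-- The function on the integer plane that extends a matrix by ones. -/
def extendByOne {n m : ℕ} (M : Matrix (Fin n) (Fin m) ℤ) (i j : ℤ) : ℤ :=
  -- The value `1` outside serves only to make every value a sign; sums and squares are taken inside
  -- the matrix.
  if h : i.toNat < n ∧ j.toNat < m then M ⟨i.toNat, h.1⟩ ⟨j.toNat, h.2⟩ else 1

theorem isSign_extendByOne {n m : ℕ} {M : Matrix (Fin n) (Fin m) ℤ} (hM : IsBinary M) :
    IsSign (extendByOne M) := fun i j => by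
  unfold extendByOne
  split
  exacts [hM _ _, Or.inl rfl]

theorem extendByOne_coe {n m : ℕ} (M : Matrix (Fin n) (Fin m) ℤ) {i j : ℕ} (hi : i < n)
    (hj : j < m) : extendByOne M i j = M ⟨i, hi⟩ ⟨j, hj⟩ := by
  simp [extendByOne, hi, hj]

theorem rectSum_extendByOne {n m : ℕ} (M : Matrix (Fin n) (Fin m) ℤ) :
    rectSum (extendByOne M) 0 0 n m = disc M := by
  unfold rectSum disc
  rw [Finset.sum_range]
  refine Finset.sum_congr rfl fun i _ => ?_
  rw [Finset.sum_range]
  refine Finset.sum_congr rfl fun j _ => ?_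
  rw [zero_add, zero_add, extendByOne_coe M i.2 j.2]

theorem disc_squareAt {n m : ℕ} (M : Matrix (Fin n) (Fin m) ℤ) (i j s : ℕ) (hi : i + s < n)
    (hj : j + s < m) : disc (squareAt M i j s hi hj) =
      M ⟨i, by omega⟩ ⟨j, by omega⟩ + M ⟨i, by omega⟩ ⟨j + s, hj⟩ +
        (M ⟨i + s, hi⟩ ⟨j, by omega⟩ + M ⟨i + s, hi⟩ ⟨j + s, hj⟩) := by
  simp [disc, squareAt, Fin.sum_univ_two]

theorem squareFreeOn_extendByOne {n m : ℕ} {M : Matrix (Fin n) (Fin m) ℤ}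
    (hM : ¬ HasZeroSumSquare M) : SquareFreeOn (extendByOne M) 0 0 n m := by
  intro i j s hs hi hi' hj hj' h0
  lift i to ℕ using hi
  lift j to ℕ using hj
  lift s to ℕ using hs.le
  refine hM ⟨i, j, s, by omega, by omega, by omega, ?_⟩
  rw [disc_squareAt, ← h0, ← Nat.cast_add, ← Nat.cast_add, extendByOne_coe M (by omega) (by omega),
    extendByOne_coe M (by omega) (by omega), extendByOne_coe M (by omega) (by omega),
    extendByOne_coe M (by omega) (by omega)]
  ring

/-! ### Discrepancies of split matrices -/

theorem disc_neg {n m : ℕ} (M : Matrix (Fin n) (Fin m) ℤ) : disc (-M) = -disc M := by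
  simp [disc]

theorem disc_reverse_columns {n m : ℕ} (M : Matrix (Fin n) (Fin m) ℤ) :
    disc (M.submatrix id Fin.rev) = disc M :=
  Finset.sum_congr rfl fun i _ => Equiv.sum_comp Fin.revPerm (M i)

theorem disc_reverse_rows {n m : ℕ} (M : Matrix (Fin n) (Fin m) ℤ) :
    disc (M.submatrix Fin.rev id) = disc M :=
  Equiv.sum_comp Fin.revPerm fun i => ∑ j, M i j

theorem sum_range_ite_lt (n k : ℕ) :
    ∑ j ∈ Finset.range n, (if j < k then (-1 : ℤ) else 1) = n - 2 * (min n k : ℕ) := by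
  induction n with
  | zero => simp
  | succ n ih =>
    rw [Finset.sum_range_succ, ih]
    split <;> push_cast <;> omega

theorem IsTSplit.disc_eq {n t : ℕ} {M : Matrix (Fin n) (Fin n) ℤ} (h : IsTSplit t M) :
    disc M = ∑ i ∈ Finset.range n, ((n : ℤ) - 2 * (min n (t - i) : ℕ)) := by
  unfold disc
  rw [Finset.sum_range]
  refine Finset.sum_congr rfl fun i _ => ?_
  rw [← sum_range_ite_lt, Finset.sum_range]
  refine Finset.sum_congr rfl fun j _ => ?_
  rw [h.2 i j]
  split <;> split <;> omega

theorem sum_range_add_two_mul (c : ℤ) (n : ℕ) :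
    ∑ i ∈ Finset.range n, (c + 2 * (i : ℤ)) = n * (c + n - 1) := by
  induction n with
  | zero => simp
  | succ n ih =>
    rw [Finset.sum_range_succ, ih]
    push_cast
    ring

/-- Row sums are compared with those for `t = n - 1` and `t = n`, which total `n` and `-n`: a
smaller `t` gives more than `n`, a larger one less than `-n`. -/
theorem IsTSplit.abs_disc_eq {n t : ℕ} {M : Matrix (Fin n) (Fin n) ℤ} (h : IsTSplit t M)
    (hd : |disc M| ≤ n) : |disc M| = n := by
  have ht := h.1
  rw [abs_le] at hd
  rw [h.disc_eq] at hd ⊢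
  have lo := sum_range_add_two_mul (2 - n) n
  have hi := sum_range_add_two_mul (-n) n
  rw [show (n : ℤ) * (2 - n + n - 1) = n by ring] at lo
  rw [show (n : ℤ) * (-n + n - 1) = -n by ring] at hi
  rcases (by omega : t + 1 < n ∨ t + 1 = n ∨ t = n ∨ n < t) with htn | htn | htn | htn
  · have : ∑ i ∈ Finset.range n, ((2 - n : ℤ) + 2 * (i : ℤ)) <
        ∑ i ∈ Finset.range n, ((n : ℤ) - 2 * (min n (t - i) : ℕ)) := by
      refine Finset.sum_lt_sum (fun i hi => ?_) ⟨0, Finset.mem_range.mpr (by omega), by omega⟩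
      have := Finset.mem_range.mp hi
      omega
    omega
  · have : ∑ i ∈ Finset.range n, ((n : ℤ) - 2 * (min n (t - i) : ℕ)) =
        ∑ i ∈ Finset.range n, ((2 - n : ℤ) + 2 * (i : ℤ)) := by
      refine Finset.sum_congr rfl fun i hi => ?_
      have := Finset.mem_range.mp hi
      omega
    rw [this, lo, Nat.abs_cast]
  · have : ∑ i ∈ Finset.range n, ((n : ℤ) - 2 * (min n (t - i) : ℕ)) =
        ∑ i ∈ Finset.range n, ((-n : ℤ) + 2 * (i : ℤ)) := by
      refine Finset.sum_congr rfl fun i hi => ?_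
      have := Finset.mem_range.mp hi
      omega
    rw [this, hi, abs_neg, Nat.abs_cast]
  · have : ∑ i ∈ Finset.range n, ((n : ℤ) - 2 * (min n (t - i) : ℕ)) <
        ∑ i ∈ Finset.range n, ((-n : ℤ) + 2 * (i : ℤ)) := by
      -- Row `0` consists of `-1` already for `t = n`, so the strict drop occurs in row `1`, which
      -- exists because `n < t < 2 * n`.
      refine Finset.sum_lt_sum (fun i hi => ?_) ⟨1, Finset.mem_range.mpr (by omega), by omega⟩
      have := Finset.mem_range.mp hi
      omega
    omega

theorem IsSplit.abs_disc_eq {n : ℕ} {M : Matrix (Fin n) (Fin n) ℤ} (h : IsSplit M)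
    (hd : |disc M| ≤ n) : |disc M| = n := by
  obtain ⟨t, h | h | h | h⟩ := h
  · exact h.abs_disc_eq hd
  · rw [← abs_neg, ← disc_neg] at hd ⊢
    exact h.abs_disc_eq hd
  · rw [← disc_reverse_columns] at hd ⊢
    exact h.abs_disc_eq hd
  · rw [← disc_reverse_rows] at hd ⊢
    exact h.abs_disc_eq hd

theorem corollary1p4 :
    (∀ (n : ℕ), 5 ≤ n → ∀ M : Matrix (Fin n) (Fin n) ℤ, IsBinary M →
      |disc M| ≤ (n : ℤ) - 1 → HasZeroSumSquare M) ∧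
    (∀ (n : ℕ) (M : Matrix (Fin n) (Fin n) ℤ), IsSplit M →
      |disc M| ≤ (n : ℤ) → |disc M| = (n : ℤ)) := by
  refine ⟨fun n hn M hM hd => ?_, fun n M h hd => h.abs_disc_eq hd⟩
  by_contra hZ
  refine not_anyMidSplit_square (extendByOne M) 0 0 n ?_
  refine (smallSumSplit_all n hn).1 _ (isSign_extendByOne hM) 0 0 (squareFreeOn_extendByOne hZ) ?_
  rw [rectSum_extendByOne]
  omega
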